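/- Let $P$ be a submonoid of a group $G$ that is right LCM: for all $p,q\in P$ with $pP\cap qP\neq\emptyset$ there is $w\in P$ with $pP\cap qP=wP$. Let $A$ be a C*-algebra and let $X=\{X_p\}_{p\in P}$ be a product system over $P$ with coefficients in $A$: each $X_p$ is a C*-correspondence over $A$ with nondegenerate left action $\varphi_p\colon A\to\mathcal L(X_p)$, $X_e={}_AA_A$, and there are associative multiplication maps inducing unitary equivalences $X_p\otimes_A X_q\cong X_{pq}$, which for $p=e$ (respectively $q=e$) are given by the left (respectively right) action of $A$. For $r\in pP$ let $i_p^{r}\colon\mathcal L(X_p)\to\mathcal L(X_r)$ be given by $i_p^r(T)(\xi_p\xi_{p^{-1}r})=(T\xi_p)\xi_{p^{-1}r}$. Suppose that $X$ is compactly aligned: $i_p^w(k_p)\,i_q^w(k_q)\in\mathcal K(X_w)$ whenever $pP\cap qP=wP$, $k_p\in\mathcal K(X_p)$, $k_q\in\mathcal K(X_q)$. Let $H$ be a Hilbert space and let $t=\{t_p\}_{p\in P}$, $t_p\colon X_p\to\mathcal B(H)$, be a Toeplitz representation of $X$: the $t_p$ are linear, $t_e$ is a $*$-homomorphism, $t_p(\xi)^*t_p(\eta)=t_e(\langle\xi,\eta\rangle)$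 for $\xi,\eta\in X_p$, and $t_p(\xi_p)t_q(\xi_q)=t_{pq}(\xi_p\xi_q)$. Write also $t_p\colon\mathcal K(X_p)\to\mathcal B(H)$ for the induced representation with $t_p(\theta_{\xi,\eta})=t_p(\xi)t_p(\eta)^*$, where $\theta_{\xi,\eta}(\zeta)=\xi\langle\eta,\zeta\rangle$. Suppose that $t$ is Nica-covariant: for all $k_p\in\mathcal K(X_p)$ and $k_q\in\mathcal K(X_q)$, $$t_p(k_p)\,t_q(k_q)=\begin{cases}t_w\big(i_p^w(k_p)\,i_q^w(k_q)\big)&\text{if }pP\cap qP=wP,\\0&\text{if }pP\cap qP=\emptyset,\end{cases}$$ and that $t$ is injective, i.e. $t_e$ is injective. Let $\mathcal T_\lambda(X)$ be the C*-algebra generated by the Fock representation $\overline t$, $\overline t_p(\xi_p)\eta_r=\xi_p\eta_r$ for $\eta_r\in X_r$, in the adjointable operators on $\bigoplus_{r\in P}X_r$; let $\mathrm C^*(t)\subseteq\mathcal B(H)$ be the C*-algebra generated by the operators $t_p(\xi_p)$; let $\mathrm C^*_\lambda(P)\subseteq\mathcal B(\ell^2(P))$ be the C*-algebra generated by the isometries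 $V_pe_r=e_{pr}$; and let $\otimes$ denote the spatial tensor product. Then there exists a faithful (injective) $*$-homomorphism $$\mathcal T_\lambda(X)\longrightarrow\mathrm C^*(t)\otimes\mathrm C^*_\lambda(P),\qquad \overline t_p(\xi_p)\longmapsto t_p(\xi_p)\otimes V_p\quad(p\in P,\ \xi_p\in X_p).$$ -/

import Mathlib

open MulOpposite
open scoped TensorProduct

set_option linter.unusedSectionVars false

noncomputable section

namespace ProdSys

section HilbertModules

variable {B : Type*} [NonUnitalCStarAlgebra B] [PartialOrder B] [StarOrderedRing B]
variable {E : Type*} [NormedAddCommGroup E] [NormedSpace ℂ E] [SMul B E] [CStarModule B E]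
variable {F : Type*} [NormedAddCommGroup F] [NormedSpace ℂ F] [SMul B F] [CStarModule B F]

variable (B) in
theorem ext_inner {x y : E} (h : ∀ z : E, inner B z x = inner B z y) : x = y := by
  have h1 : inner B (x - y) (x - y) = 0 := by
    rw [CStarModule.inner_sub_right, h (x - y), sub_self]
  exact sub_eq_zero.mp (CStarModule.inner_self.mp h1)

theorem add_smul' (a b : B) (x : E) : (a + b) • x = a • x + b • x :=
  ext_inner B fun z => by simp [add_mul]

theorem smul_smul' (c : ℂ) (a : B) (x : E) : (c • a) • x = c • (a • x) :=
  ext_inner B fun z => by simp [smul_mul_assoc]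

theorem norm_smul_le' (a : B) (x : E) : ‖a • x‖ ≤ ‖a‖ * ‖x‖ := by
  have h : ‖a • x‖ ^ 2 ≤ (‖a‖ * ‖x‖) ^ 2 := by
    rw [CStarModule.norm_sq_eq B, mul_pow, CStarModule.norm_sq_eq B (x := x)]
    simp only [CStarModule.inner_op_smul_right, CStarModule.inner_op_smul_left]
    calc ‖a * (inner B x x * star a)‖ ≤ ‖a‖ * (‖inner B x x‖ * ‖star a‖) :=
          (norm_mul_le _ _).trans (by gcongr; exact norm_mul_le _ _)
      _ = _ := by rw [norm_star]; ring
  exact le_of_sq_le_sq h (by positivity) 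

variable (B) in
theorem norm_le_of_inner_le (x : E) (c : ℝ) (hc : 0 ≤ c)
    (h : ‖inner B x x‖ ≤ c * ‖x‖) : ‖x‖ ≤ c := by
  rw [← CStarModule.norm_sq_eq B] at h
  rcases (norm_nonneg x).eq_or_lt with h0 | h0
  · rw [← h0]; exact hc
  · nlinarith

variable (B E) in
/-- The adjointable operators on the Hilbert module `E`, that is, the (bounded) operators `T` for
which there is a (bounded) `S` with `⟪T x, y⟫ = ⟪x, S y⟫`, as a subalgebra. -/
def adjointableSubalgebra : Subalgebra ℂ (E →L[ℂ] E) where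
  carrier := {T | ∃ S : E →L[ℂ] E, ∀ x y : E, inner B (T x) y = inner B x (S y)}
  mul_mem' := by
    rintro T T' ⟨S, hS⟩ ⟨S', hS'⟩
    exact ⟨S' * S, fun x y => by simp [hS, hS']⟩
  add_mem' := by
    rintro T T' ⟨S, hS⟩ ⟨S', hS'⟩
    exact ⟨S + S', fun x y => by simp [hS, hS']⟩
  algebraMap_mem' c := ⟨algebraMap ℂ _ (star c), fun x y => by
    simp [Algebra.algebraMap_eq_smul_one]⟩

variable (B E) in
/-- `L(E)`: the normed algebra of adjointable operators on the Hilbert module `E`, with the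
operator norm. -/
def Adjointable : Type _ := adjointableSubalgebra B E

instance : NormedRing (Adjointable B E) :=
  inferInstanceAs (NormedRing (adjointableSubalgebra B E))

instance : NormedAlgebra ℂ (Adjointable B E) :=
  inferInstanceAs (NormedAlgebra ℂ (adjointableSubalgebra B E))

namespace Adjointable

@[simp] theorem val_add (S T : Adjointable B E) : (S + T).1 = S.1 + T.1 := rfl
@[simp] theorem val_sub (S T : Adjointable B E) : (S - T).1 = S.1 - T.1 := rfl
@[simp] theorem val_mul (S T : Adjointable B E) : (S * T).1 = S.1 * T.1 := rfl
@[simp] theorem val_smul (c : ℂ) (T : Adjointable B E) : (c • T).1 = c • T.1 := rfl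
@[simp] theorem val_zero : (0 : Adjointable B E).1 = 0 := rfl
@[simp] theorem val_one : (1 : Adjointable B E).1 = 1 := rfl
theorem norm_val (T : Adjointable B E) : ‖T.1‖ = ‖T‖ := rfl

end Adjointable

theorem adjoint_unique {S S' : E →L[ℂ] E} {T : E → E}
    (h : ∀ x y : E, inner B (T x) y = inner B x (S y))
    (h' : ∀ x y : E, inner B (T x) y = inner B x (S' y)) : S = S' := by
  ext y
  exact ext_inner B fun z => by rw [← h, ← h']

/-- The involution of `L(E)`: `star T` is the adjoint of `T`. -/
instance : Star (Adjointable B E) where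
  star T := ⟨T.2.choose, T.1, fun x y => by
    rw [← CStarModule.star_inner, ← T.2.choose_spec, CStarModule.star_inner]⟩

theorem inner_apply_left (T : Adjointable B E) (x y : E) :
    inner B (T.1 x) y = inner B x ((star T).1 y) := T.2.choose_spec x y

theorem inner_apply_right (T : Adjointable B E) (x y : E) :
    inner B x (T.1 y) = inner B ((star T).1 x) y := by
  rw [← CStarModule.star_inner, inner_apply_left, CStarModule.star_inner]

theorem star_eq_of {S T : Adjointable B E}
    (h : ∀ x y : E, inner B (T.1 x) y = inner B x (S.1 y)) : star T = S :=
  Subtype.ext (adjoint_unique (inner_apply_left T) h)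

instance : StarRing (Adjointable B E) where
  star_involutive T := star_eq_of fun x y => (inner_apply_right T x y).symm
  star_mul S T := star_eq_of fun x y => by
    simp [inner_apply_left]
  star_add S T := star_eq_of fun x y => by
    simp [inner_apply_left]

instance : StarModule ℂ (Adjointable B E) where
  star_smul c T := star_eq_of fun x y => by
    simp [inner_apply_left]

theorem norm_sq_le (T : Adjointable B E) : ‖T‖ * ‖T‖ ≤ ‖star T * T‖ := by
  have h : ‖T‖ ≤ Real.sqrt ‖star T * T‖ := by
    refine ContinuousLinearMap.opNorm_le_bound _ (Real.sqrt_nonneg _) fun x => ?_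
    change ‖T.1 x‖ ≤ _
    refine le_of_sq_le_sq ?_ (by positivity)
    have hn : 0 ≤ ‖star T * T‖ := norm_nonneg _
    rw [mul_pow, Real.sq_sqrt hn, CStarModule.norm_sq_eq B]
    calc ‖inner B (T.1 x) (T.1 x)‖ = ‖inner B x ((star T * T).1 x)‖ := by
          rw [inner_apply_left]; rfl
      _ ≤ ‖x‖ * ‖(star T * T).1 x‖ := CStarModule.norm_inner_le E
      _ ≤ ‖x‖ * (‖star T * T‖ * ‖x‖) := by
          gcongr; exact (star T * T).1.le_opNorm x
      _ = _ := by ring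
  calc ‖T‖ * ‖T‖ ≤ Real.sqrt ‖star T * T‖ * Real.sqrt ‖star T * T‖ := by gcongr
    _ = _ := Real.mul_self_sqrt (norm_nonneg _)

instance : CStarRing (Adjointable B E) where
  norm_mul_self_le T := by
    have h0 : ∀ S : Adjointable B E, ‖S‖ ≤ ‖star S‖ := fun S => by
      have h1 := (norm_sq_le S).trans (norm_mul_le _ _)
      rcases (norm_nonneg S).eq_or_lt with h | h
      · rw [← h]; exact norm_nonneg _
      · exact le_of_mul_le_mul_right h1 h
    exact norm_sq_le T

instance [CompleteSpace E] : CompleteSpace (Adjointable B E) := by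
  have hc : IsClosed (adjointableSubalgebra B E : Set (E →L[ℂ] E)) := ?_
  · exact hc.completeSpace_coe
  refine IsSeqClosed.isClosed fun u T hu hT => ?_
  let v : ℕ → Adjointable B E := fun n => ⟨u n, hu n⟩
  have hv : CauchySeq v := by
    have := hT.cauchySeq
    rw [Metric.cauchySeq_iff] at this ⊢
    exact this
  have hs : CauchySeq fun n => (star (v n)).1 := by
    rw [Metric.cauchySeq_iff] at hv ⊢
    intro ε hε
    obtain ⟨N, hN⟩ := hv ε hε
    refine ⟨N, fun m hm n hn => ?_⟩
    have := hN m hm n hn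
    rw [dist_eq_norm] at this ⊢
    have h2 : ‖star (v m) - star (v n)‖ = ‖v m - v n‖ := by
      have h3 : star (v m) - star (v n) = star (v m - v n) := (star_sub _ _).symm
      exact h3 ▸ norm_star (v m - v n)
    calc ‖(star (v m)).1 - (star (v n)).1‖ = ‖star (v m) - star (v n)‖ := rfl
      _ < ε := by rw [h2]; exact this
  obtain ⟨S, hS⟩ := cauchySeq_tendsto_of_complete hs
  refine ⟨S, fun x y => ?_⟩
  have e1 : Filter.Tendsto (fun n => inner B (u n x) y) Filter.atTop (nhds (inner B (T x) y)) := by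
    have hx : Filter.Tendsto (fun n => u n x) Filter.atTop (nhds (T x)) :=
      ((ContinuousLinearMap.apply ℂ E x).continuous.tendsto T).comp hT
    exact ((CStarModule.continuous_inner (A := B) (E := E)).tendsto (T x, y)).comp
      (hx.prodMk_nhds tendsto_const_nhds)
  have e2 : Filter.Tendsto (fun n => inner B (u n x) y) Filter.atTop (nhds (inner B x (S y))) := by
    have hy : Filter.Tendsto (fun n => (star (v n)).1 y) Filter.atTop (nhds (S y)) :=
      ((ContinuousLinearMap.apply ℂ E y).continuous.tendsto S).comp hS
    have := ((CStarModule.continuous_inner (A := B) (E := E)).tendsto (x, S y)).comp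
      (tendsto_const_nhds.prodMk_nhds hy)
    refine this.congr fun n => ?_
    exact (inner_apply_left (v n) x y).symm
  exact tendsto_nhds_unique e1 e2

instance [CompleteSpace E] : CStarAlgebra (Adjointable B E) where

/-- The rank one operator `θ_{x,y} : z ↦ x⟪y, z⟫`, as a bounded operator. -/
def rankOneL (x y : E) : E →L[ℂ] E :=
  LinearMap.mkContinuous
    { toFun := fun z => inner B y z • x
      map_add' := fun z w => by rw [CStarModule.inner_add_right, add_smul']
      map_smul' := fun c z => by
        rw [CStarModule.inner_smul_right_complex, smul_smul']; rfl }
    (‖y‖ * ‖x‖) (fun z => by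
      calc ‖inner B y z • x‖ ≤ ‖inner B y z‖ * ‖x‖ := norm_smul_le' _ _
        _ ≤ (‖y‖ * ‖z‖) * ‖x‖ := by gcongr; exact CStarModule.norm_inner_le E
        _ = _ := by ring)

variable (B) in
/-- The rank one operator `θ_{x,y} : z ↦ x⟪y, z⟫`, as an adjointable operator. -/
def rankOne (x y : E) : Adjointable B E :=
  ⟨rankOneL (B := B) x y, rankOneL (B := B) y x, fun z w => by simp [rankOneL]⟩

theorem rankOne_apply (x y z : E) : (rankOne B x y).1 z = inner B y z • x := rfl

theorem star_rankOne (x y : E) : star (rankOne B x y) = rankOne B y x :=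
  star_eq_of fun z w => by simp [rankOne_apply]

variable (B E) in
/-- `K(E)`: the norm closed linear span of the rank one operators in `L(E)`. -/
def Compacts : Submodule ℂ (Adjointable B E) :=
  (Submodule.span ℂ {k | ∃ x y : E, k = rankOne B x y}).topologicalClosure

end HilbertModules

section Balanced

variable {B : Type*} [NonUnitalCStarAlgebra B] [PartialOrder B] [StarOrderedRing B]
variable {E : Type*} [NormedAddCommGroup E] [NormedSpace ℂ E] [SMul B E] [CStarModule B E]
variable {B' : Type*} [NonUnitalCStarAlgebra B'] [PartialOrder B'] [StarOrderedRing B']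
variable {W : Type*} [NormedAddCommGroup W] [NormedSpace ℂ W] [SMul B' W] [CStarModule B' W]
variable {V : Type*} [AddCommGroup V] [Module ℂ V]

/-- `u ↦ m ((T ⊗ 1) u)`. -/
def act (m : E ⊗[ℂ] V →ₗ[ℂ] W) (T : Adjointable B E) : E ⊗[ℂ] V →ₗ[ℂ] W :=
  m ∘ₗ TensorProduct.map T.1.toLinearMap LinearMap.id

theorem act_tmul (m : E ⊗[ℂ] V →ₗ[ℂ] W) (T : Adjointable B E) (x : E) (v : V) :
    act m T (x ⊗ₜ v) = m (T.1 x ⊗ₜ v) := rfl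

variable (B B') in
/-- A linear map `m` on `E ⊗ V` is balanced if `T ⊗ 1` and `T* ⊗ 1` are formally adjoint for
the inner product that `m` induces on `E ⊗ V`. -/
def IsBalanced (m : E ⊗[ℂ] V →ₗ[ℂ] W) : Prop :=
  ∀ (T : Adjointable B E) (x y : E) (v w : V),
    inner B' (m (T.1 x ⊗ₜ v)) (m (y ⊗ₜ w)) = inner B' (m (x ⊗ₜ v)) (m ((star T).1 y ⊗ₜ w))

theorem IsBalanced.inner_act {m : E ⊗[ℂ] V →ₗ[ℂ] W} (hm : IsBalanced B B' m)
    (T : Adjointable B E) (u u' : E ⊗[ℂ] V) :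
    inner B' (act m T u) (m u') = inner B' (m u) (act m (star T) u') := by
  induction u with
  | zero => simp
  | add a b ha hb => simp [ha, hb]
  | tmul x v =>
    induction u' with
    | zero => simp
    | add a b ha hb => simp [ha, hb]
    | tmul y w => exact hm T x y v w

theorem act_act (m : E ⊗[ℂ] V →ₗ[ℂ] W) (S T : Adjointable B E) (u : E ⊗[ℂ] V) :
    act m S (TensorProduct.map T.1.toLinearMap LinearMap.id u) = act m (S * T) u := by
  induction u with
  | zero => simp
  | add a b ha hb => simp [ha, hb]
  | tmul x v => rfl

theorem IsBalanced.inner_act_act {m : E ⊗[ℂ] V →ₗ[ℂ] W} (hm : IsBalanced B B' m)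
    (T : Adjointable B E) (u : E ⊗[ℂ] V) :
    inner B' (act m T u) (act m T u) = inner B' (m u) (act m (star T * T) u) := by
  have := hm.inner_act T u (TensorProduct.map T.1.toLinearMap LinearMap.id u)
  rw [act_act] at this
  exact this

theorem act_add (m : E ⊗[ℂ] V →ₗ[ℂ] W) (S T : Adjointable B E) (u : E ⊗[ℂ] V) :
    act m (S + T) u = act m S u + act m T u := by
  induction u with
  | zero => simp
  | add a b ha hb => simp only [map_add, ha, hb]; abel
  | tmul x v => simp [act_tmul, TensorProduct.add_tmul]

theorem act_smul (m : E ⊗[ℂ] V →ₗ[ℂ] W) (c : ℂ) (T : Adjointable B E) (u : E ⊗[ℂ] V) :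
    act m (c • T) u = c • act m T u := by
  induction u with
  | zero => simp
  | add a b ha hb => simp only [map_add, ha, hb, smul_add]
  | tmul x v =>
    rw [act_tmul, act_tmul, ← map_smul, TensorProduct.smul_tmul']
    rfl

theorem act_neg (m : E ⊗[ℂ] V →ₗ[ℂ] W) (T : Adjointable B E) (u : E ⊗[ℂ] V) :
    act m (-T) u = -act m T u := by
  rw [← neg_one_smul ℂ T, act_smul, neg_one_smul]

theorem act_one (m : E ⊗[ℂ] V →ₗ[ℂ] W) (u : E ⊗[ℂ] V) :
    act m (1 : Adjointable B E) u = m u := by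
  induction u with
  | zero => simp
  | add a b ha hb => simp only [map_add, ha, hb]
  | tmul x v => rfl

theorem exists_sqrt [CompleteSpace E] (T : Adjointable B E) :
    ∃ R : Adjointable B E, star R * R = ((‖star T * T‖ : ℝ) : ℂ) • 1 - star T * T := by
  let _ := CStarAlgebra.spectralOrder (Adjointable B E)
  have := CStarAlgebra.spectralOrderedRing (Adjointable B E)
  have h : star T * T ≤ algebraMap ℝ (Adjointable B E) ‖star T * T‖ :=
    IsSelfAdjoint.le_algebraMap_norm_self (IsSelfAdjoint.star_mul_self T)
  have h0 := sub_nonneg.mpr h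
  obtain ⟨R, hR⟩ := CStarAlgebra.nonneg_iff_eq_star_mul_self.mp h0
  refine ⟨R, hR.symm.trans ?_⟩
  rw [Algebra.algebraMap_eq_smul_one]
  simp

theorem IsBalanced.inner_act_le [CompleteSpace E] {m : E ⊗[ℂ] V →ₗ[ℂ] W}
    (hm : IsBalanced B B' m) (T : Adjointable B E) (u : E ⊗[ℂ] V) :
    inner B' (act m T u) (act m T u) ≤ (‖T‖ ^ 2) • inner B' (m u) (m u) := by
  obtain ⟨R, hR⟩ := exists_sqrt T
  have h1 : (0 : B') ≤ inner B' (act m R u) (act m R u) := CStarModule.inner_self_nonneg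
  rw [hm.inner_act_act, hR] at h1
  have h2 : act m (((‖star T * T‖ : ℝ) : ℂ) • 1 - star T * T) u
      = ((‖star T * T‖ : ℝ) : ℂ) • m u - act m (star T * T) u := by
    rw [sub_eq_add_neg, sub_eq_add_neg, act_add, act_smul, act_one, act_neg]
  rw [h2, CStarModule.inner_sub_right, ← hm.inner_act_act, sub_nonneg,
    CStarModule.inner_smul_right_complex, CStarRing.norm_star_mul_self, ← sq] at h1
  rw [show ‖T‖ ^ 2 • inner B' (m u) (m u) = ((‖T‖ ^ 2 : ℝ) : ℂ) • inner B' (m u) (m u) from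
    (Complex.coe_smul _ _).symm]
  exact h1

theorem IsBalanced.norm_act_le [CompleteSpace E] {m : E ⊗[ℂ] V →ₗ[ℂ] W}
    (hm : IsBalanced B B' m) (T : Adjointable B E) (u : E ⊗[ℂ] V) :
    ‖act m T u‖ ≤ ‖T‖ * ‖m u‖ := by
  refine le_of_sq_le_sq ?_ (by positivity)
  rw [mul_pow, CStarModule.norm_sq_eq B', CStarModule.norm_sq_eq B' (x := m u)]
  calc _ ≤ ‖(‖T‖ ^ 2) • inner B' (m u) (m u)‖ :=
        CStarAlgebra.norm_le_norm_of_nonneg_of_le CStarModule.inner_self_nonneg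
          (hm.inner_act_le T u)
    _ = _ := by rw [norm_smul]; simp

end Balanced

section Extend

variable {B : Type*} [NonUnitalCStarAlgebra B] [PartialOrder B] [StarOrderedRing B]
variable {E : Type*} [NormedAddCommGroup E] [NormedSpace ℂ E] [SMul B E] [CStarModule B E]
variable {B' : Type*} [NonUnitalCStarAlgebra B'] [PartialOrder B'] [StarOrderedRing B']
variable {W : Type*} [NormedAddCommGroup W] [NormedSpace ℂ W] [SMul B' W] [CStarModule B' W]
variable {V : Type*} [AddCommGroup V] [Module ℂ V]
variable [CompleteSpace E] [CompleteSpace W]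

/-- If `m : E ⊗ V → W` is balanced with dense range, then every `T ∈ L(E)` induces the operator
`m (x ⊗ v) ↦ m (T x ⊗ v)` in `L(W)`. -/
def extendAct (m : E ⊗[ℂ] V →ₗ[ℂ] W) (hm : IsBalanced B B' m) (hd : DenseRange m)
    (T : Adjointable B E) : Adjointable B' W :=
  ⟨(act m T).extendOfNorm m, (act m (star T)).extendOfNorm m, by
    have e : ∀ (S : Adjointable B E) (u : E ⊗[ℂ] V),
        (act m S).extendOfNorm m (m u) = act m S u := fun S u =>
      LinearMap.extendOfNorm_eq hd ⟨‖S‖, hm.norm_act_le S⟩ u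
    intro x y
    refine hd.induction_on₂ (p := fun x y => inner B' ((act m T).extendOfNorm m x) y =
      inner B' x ((act m (star T)).extendOfNorm m y)) ?_ (fun a b => ?_) x y
    · refine isClosed_eq ?_ ?_
      · exact (CStarModule.continuous_inner (A := B') (E := W)).comp
          (((ContinuousLinearMap.continuous _).comp continuous_fst).prodMk continuous_snd)
      · exact (CStarModule.continuous_inner (A := B') (E := W)).comp
          (continuous_fst.prodMk ((ContinuousLinearMap.continuous _).comp continuous_snd))
    · rw [e, e]
      exact hm.inner_act T a b⟩

theorem extendAct_apply (m : E ⊗[ℂ] V →ₗ[ℂ] W) (hm : IsBalanced B B' m) (hd : DenseRange m)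
    (T : Adjointable B E) (x : E) (v : V) :
    (extendAct m hm hd T).1 (m (x ⊗ₜ v)) = m (T.1 x ⊗ₜ v) :=
  LinearMap.extendOfNorm_eq hd ⟨‖T‖, hm.norm_act_le T⟩ (x ⊗ₜ v)

end Extend

section Induced

open scoped ComplexOrder

variable {B : Type*} [NonUnitalCStarAlgebra B] [PartialOrder B] [StarOrderedRing B]
variable {E : Type*} [NormedAddCommGroup E] [NormedSpace ℂ E] [SMul B E] [CStarModule B E]
variable {H : Type*} [NormedAddCommGroup H] [InnerProductSpace ℂ H] [CompleteSpace H]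
variable [CompleteSpace E]

/-- `x ⊗ h ↦ t(x) h`. -/
def evalMap (t : E →ₗ[ℂ] (H →L[ℂ] H)) : E ⊗[ℂ] H →ₗ[ℂ] H :=
  TensorProduct.lift ((ContinuousLinearMap.coeLM ℂ) ∘ₗ t)

theorem evalMap_tmul (t : E →ₗ[ℂ] (H →L[ℂ] H)) (x : E) (h : H) :
    evalMap t (x ⊗ₜ h) = t x h := rfl

theorem evalMap_isBalanced (t : E →ₗ[ℂ] (H →L[ℂ] H)) (π : B → (H →L[ℂ] H))
    (ht : ∀ x y, π (inner B x y) = star (t x) * t y) : IsBalanced B ℂ (evalMap t) := by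
  intro T x y v w
  have e : ∀ (x y : E) (v w : H),
      inner ℂ (t x v) (t y w) = inner ℂ v (π (inner B x y) w) := fun x y v w => by
    rw [ht, mul_apply_eq_comp, ContinuousLinearMap.star_eq_adjoint,
      ContinuousLinearMap.adjoint_inner_right]
  simp only [evalMap_tmul]
  rw [e, e, inner_apply_left]

/-- The span of the pairs `(θ_{x,y}, t(x) t(y)*)`. -/
def finiteRankGraph (B : Type*) [NonUnitalCStarAlgebra B] [PartialOrder B] [StarOrderedRing B]
    [SMul B E] [CStarModule B E] (t : E →ₗ[ℂ] (H →L[ℂ] H)) :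
    Submodule ℂ (Adjointable B E × (H →L[ℂ] H)) :=
  Submodule.span ℂ {z | ∃ x y : E, z = (rankOne B x y, t x * star (t y))}

theorem fst_mem_compacts {t : E →ₗ[ℂ] (H →L[ℂ] H)} (z : finiteRankGraph B t) :
    z.1.1 ∈ Compacts B E := by
  refine Submodule.le_topologicalClosure _ ?_
  obtain ⟨z, hz⟩ := z
  induction hz using Submodule.span_induction with
  | mem z h =>
    obtain ⟨x, y, rfl⟩ := h
    exact Submodule.subset_span ⟨x, y, rfl⟩
  | zero => exact Submodule.zero_mem _
  | add a b _ _ ha hb => exact Submodule.add_mem _ ha hb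
  | smul c a _ ha => exact Submodule.smul_mem _ c ha

/-- The first coordinate of the graph, as an element of `K(E)`. -/
def graphFst (t : E →ₗ[ℂ] (H →L[ℂ] H)) : finiteRankGraph B t →ₗ[ℂ] Compacts B E :=
  (LinearMap.fst ℂ _ _ ∘ₗ (finiteRankGraph B t).subtype).codRestrict _ fst_mem_compacts

/-- The second coordinate of the graph. -/
def graphSnd (t : E →ₗ[ℂ] (H →L[ℂ] H)) : finiteRankGraph B t →ₗ[ℂ] (H →L[ℂ] H) :=
  LinearMap.snd ℂ _ _ ∘ₗ (finiteRankGraph B t).subtype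

theorem graph_spec (t : E →ₗ[ℂ] (H →L[ℂ] H)) (π : B → (H →L[ℂ] H))
    (ht : ∀ x y, π (inner B x y) = star (t x) * t y)
    (hs : ∀ (b : B) (x : E), t (b • x) = t x * π b) (z : finiteRankGraph B t) :
    (∀ u, z.1.2 (evalMap t u) = act (evalMap t) z.1.1 u) ∧
      ∀ h, ∃ u, star z.1.2 h = evalMap t u := by
  obtain ⟨z, hz⟩ := z
  induction hz using Submodule.span_induction with
  | mem z h =>
    obtain ⟨x, y, rfl⟩ := h
    refine ⟨fun u => ?_, fun h => ⟨y ⊗ₜ (star (t x) h), ?_⟩⟩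
    · induction u with
      | zero => simp
      | add a b ha hb => simp only [map_add, ha, hb]
      | tmul a h =>
        rw [act_tmul, rankOne_apply, evalMap_tmul, evalMap_tmul, hs, ht]
        rfl
    · rw [evalMap_tmul]; simp
  | zero => exact ⟨fun u => by
      have : act (evalMap t) (0 : Adjointable B E) u = 0 := by
        rw [← zero_smul ℂ (0 : Adjointable B E), act_smul, zero_smul]
      simpa using this.symm, fun h => ⟨0, by simp⟩⟩
  | add a b _ _ ha hb =>
    refine ⟨fun u => ?_, fun h => ?_⟩
    · have h1 := ha.1 u
      have h2 := hb.1 u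
      simp only at h1 h2
      change (a.2 + b.2) _ = act (evalMap t) (a.1 + b.1) u
      rw [act_add, ← h1, ← h2]; rfl
    · obtain ⟨u, hu⟩ := ha.2 h
      obtain ⟨v, hv⟩ := hb.2 h
      simp only at hu hv
      refine ⟨u + v, ?_⟩
      change star (a.2 + b.2) h = _
      rw [star_add, map_add, ← hu, ← hv]; rfl
  | smul c a _ ha =>
    refine ⟨fun u => ?_, fun h => ?_⟩
    · have h1 := ha.1 u
      simp only at h1
      change (c • a.2) _ = act (evalMap t) (c • a.1) u
      rw [act_smul, ← h1]; rfl
    · obtain ⟨u, hu⟩ := ha.2 h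
      simp only at hu
      refine ⟨star c • u, ?_⟩
      change star (c • a.2) h = _
      rw [star_smul, map_smul, ← hu]; rfl

theorem graph_norm_le (t : E →ₗ[ℂ] (H →L[ℂ] H)) (π : B → (H →L[ℂ] H))
    (ht : ∀ x y, π (inner B x y) = star (t x) * t y)
    (hs : ∀ (b : B) (x : E), t (b • x) = t x * π b) (z : finiteRankGraph B t) :
    ‖graphSnd t z‖ ≤ 1 * ‖graphFst t z‖ := by
  rw [one_mul]
  obtain ⟨h1, h2⟩ := graph_spec t π ht hs z
  change ‖z.1.2‖ ≤ ‖z.1.1‖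
  have h3 : ‖z.1.2 * star z.1.2‖ ≤ ‖z.1.1‖ * ‖star z.1.2‖ := by
    refine ContinuousLinearMap.opNorm_le_bound _ (by positivity) fun h => ?_
    obtain ⟨u, hu⟩ := h2 h
    calc ‖(z.1.2 * star z.1.2) h‖ = ‖act (evalMap t) z.1.1 u‖ := by
          rw [← h1, ← hu]; rfl
      _ ≤ ‖z.1.1‖ * ‖evalMap t u‖ := (evalMap_isBalanced t π ht).norm_act_le _ _
      _ ≤ ‖z.1.1‖ * (‖star z.1.2‖ * ‖h‖) := by
          rw [← hu]; gcongr; exact ContinuousLinearMap.le_opNorm _ _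
      _ = _ := by ring
  rw [CStarRing.norm_self_mul_star, norm_star] at h3
  rcases (norm_nonneg z.1.2).eq_or_lt with h | h
  · rw [← h]; exact norm_nonneg _
  · exact le_of_mul_le_mul_right h3 h

theorem denseRange_graphFst (t : E →ₗ[ℂ] (H →L[ℂ] H)) : DenseRange (graphFst (B := B) t) := by
  intro k
  rw [Metric.mem_closure_iff]
  intro ε hε
  obtain ⟨b, hb, hd⟩ := Metric.mem_closure_iff.mp k.2 ε hε
  have key : ∃ z : finiteRankGraph B t, z.1.1 = b := by
    clear hd
    induction hb using Submodule.span_induction with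
    | mem z h =>
      obtain ⟨x, y, rfl⟩ := h
      exact ⟨⟨_, Submodule.subset_span ⟨x, y, rfl⟩⟩, rfl⟩
    | zero => exact ⟨0, rfl⟩
    | add a b _ _ ha hb =>
      obtain ⟨z, rfl⟩ := ha
      obtain ⟨w, rfl⟩ := hb
      exact ⟨z + w, rfl⟩
    | smul c a _ ha =>
      obtain ⟨z, rfl⟩ := ha
      exact ⟨c • z, rfl⟩
  obtain ⟨z, rfl⟩ := key
  exact ⟨_, ⟨z, rfl⟩, hd⟩

variable (B) in
/-- The representation of `K(E)` induced by a Toeplitz representation `t` of `E`: the continuous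
linear map with `θ_{x,y} ↦ t(x) t(y)*`. -/
def inducedRep (t : E →ₗ[ℂ] (H →L[ℂ] H)) : Compacts B E →L[ℂ] (H →L[ℂ] H) :=
  (graphSnd (B := B) t).extendOfNorm (graphFst (B := B) t)

theorem rankOne_mem (x y : E) : rankOne B x y ∈ Compacts B E :=
  Submodule.le_topologicalClosure _ (Submodule.subset_span ⟨x, y, rfl⟩)

theorem inducedRep_rankOne (t : E →ₗ[ℂ] (H →L[ℂ] H)) (π : B → (H →L[ℂ] H))
    (ht : ∀ x y, π (inner B x y) = star (t x) * t y)
    (hs : ∀ (b : B) (x : E), t (b • x) = t x * π b) (x y : E) :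
    inducedRep B t ⟨rankOne B x y, rankOne_mem x y⟩ = t x * star (t y) := by
  have hz : (rankOne B x y, t x * star (t y)) ∈ finiteRankGraph B t :=
    Submodule.subset_span ⟨x, y, rfl⟩
  exact LinearMap.extendOfNorm_eq (f := graphSnd (B := B) t) (e := graphFst (B := B) t)
    (denseRange_graphFst (B := B) t) ⟨1, graph_norm_le t π ht hs⟩ ⟨_, hz⟩

end Induced

section DirectSum

variable {B : Type*} [NonUnitalCStarAlgebra B] [PartialOrder B] [StarOrderedRing B]
variable {ι : Type*} {E : ι → Type*} [∀ i, NormedAddCommGroup (E i)] [∀ i, NormedSpace ℂ (E i)]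
  [∀ i, SMul B (E i)] [∀ i, CStarModule B (E i)]

theorem summable_of_le {a b : ι → B} (h0 : ∀ i, 0 ≤ a i) (hab : ∀ i, a i ≤ b i)
    (hb : Summable b) : Summable a := by
  rw [summable_iff_vanishing_norm] at hb ⊢
  intro ε hε
  obtain ⟨s, hs⟩ := hb ε hε
  refine ⟨s, fun t ht => lt_of_le_of_lt ?_ (hs t ht)⟩
  exact CStarAlgebra.norm_le_norm_of_nonneg_of_le (Finset.sum_nonneg fun i _ => h0 i)
    (Finset.sum_le_sum fun i _ => hab i)

variable (B E) in
/-- The families `(x_i)` with `x_i ∈ E_i` for which `∑ ⟪x_i, x_i⟫` converges in norm. -/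
def squareSummable : Submodule ℂ (∀ i, E i) where
  carrier := {x | Summable fun i => inner B (x i) (x i)}
  add_mem' := by
    intro x y hx hy
    have h2 : Summable fun i =>
        (inner B (x i) (x i) + inner B (y i) (y i)) + (inner B (x i) (x i) + inner B (y i) (y i)) :=
      (Summable.add hx hy).add (Summable.add hx hy)
    refine summable_of_le (fun i => CStarModule.inner_self_nonneg) (fun i => ?_) h2
    have h : (0 : B) ≤ inner B (x i - y i) (x i - y i) := CStarModule.inner_self_nonneg
    refine sub_nonneg.mp (h.trans_eq ?_)
    simp only [CStarModule.inner_sub_left, CStarModule.inner_sub_right, Pi.add_apply,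
      CStarModule.inner_add_left, CStarModule.inner_add_right]
    abel
  zero_mem' := by simp [summable_zero]
  smul_mem' := by
    intro c x hx
    have h : Summable fun i => (c * star c) • inner B (x i) (x i) := hx.const_smul _
    simpa [smul_smul] using h

variable (B E) in
/-- The Hilbert module direct sum `⨁ E_i`: the families `(x_i)` for which `∑ ⟪x_i, x_i⟫`
converges in norm, with the inner product `∑ ⟪x_i, y_i⟫`. -/
def HilbertSum : Type _ := squareSummable B E

namespace HilbertSum

instance : AddCommGroup (HilbertSum B E) := inferInstanceAs (AddCommGroup (squareSummable B E))

instance : Module ℂ (HilbertSum B E) := inferInstanceAs (Module ℂ (squareSummable B E))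

/-- The `i`-th coordinate. -/
def coord (x : HilbertSum B E) (i : ι) : E i := x.1 i

/-- A square summable family, as an element of the direct sum. -/
def mk (x : ∀ i, E i) (hx : Summable fun i => inner B (x i) (x i)) : HilbertSum B E := ⟨x, hx⟩

theorem ext {x y : HilbertSum B E} (h : ∀ i, x.coord i = y.coord i) : x = y :=
  Subtype.ext (funext h)

@[simp] theorem coord_mk (x : ∀ i, E i) (hx : Summable fun i => inner B (x i) (x i)) (i : ι) :
    (mk x hx).coord i = x i := rfl
@[simp] theorem coord_add (x y : HilbertSum B E) (i : ι) :
    (x + y).coord i = x.coord i + y.coord i := rfl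
@[simp] theorem coord_zero (i : ι) : (0 : HilbertSum B E).coord i = 0 := rfl
@[simp] theorem coord_smul (c : ℂ) (x : HilbertSum B E) (i : ι) :
    (c • x).coord i = c • x.coord i := rfl

theorem summable_self (x : HilbertSum B E) :
    Summable fun i => inner B (x.coord i) (x.coord i) := x.2

instance : SMul B (HilbertSum B E) where
  smul b x := mk (fun i => b • x.coord i) (by
    have := (x.summable_self.mul_left b).mul_right (star b)
    simpa [mul_assoc] using this)

@[simp] theorem coord_op_smul (b : B) (x : HilbertSum B E) (i : ι) :
    (b • x).coord i = b • x.coord i := rfl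

theorem summable_inner (x y : HilbertSum B E) :
    Summable fun i => inner B (x.coord i) (y.coord i) := by
  have h1 := (x + y).summable_self
  have h2 := (x + (-1 : ℂ) • y).summable_self
  have h3 := (x + Complex.I • y).summable_self
  have h4 := (x + (-Complex.I) • y).summable_self
  have h := ((h1.sub h2).sub (h3.const_smul Complex.I)).add (h4.const_smul Complex.I)
  have h5 := h.const_smul (1 / 4 : ℂ)
  refine h5.congr fun i => ?_
  simp only [coord_add, coord_smul, CStarModule.inner_add_left, CStarModule.inner_add_right,
    CStarModule.inner_smul_left_complex, CStarModule.inner_smul_right_complex]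
  simp only [star_neg, star_one, Complex.star_def, Complex.conj_I]
  match_scalars <;> ring_nf <;> simp <;> (try norm_num)

instance : Norm (HilbertSum B E) where
  norm x := √‖∑' i, inner B (x.coord i) (x.coord i)‖

instance : CStarModule B (HilbertSum B E) where
  inner x y := ∑' i, inner B (x.coord i) (y.coord i)
  inner_add_right {x y z} := by
    rw [← (summable_inner x y).tsum_add (summable_inner x z)]
    simp
  inner_self_nonneg := tsum_nonneg fun i => CStarModule.inner_self_nonneg
  inner_self {x} := by
    refine ⟨fun h => ext fun i => ?_, fun h => by simp [h]⟩
    have h1 := x.summable_self.le_tsum i fun j _ => CStarModule.inner_self_nonneg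
    rw [h] at h1
    exact CStarModule.inner_self.mp (le_antisymm h1 CStarModule.inner_self_nonneg)
  inner_op_smul_right {b x y} := by
    rw [← (summable_inner x y).tsum_mul_left]
    simp
  inner_smul_right_complex {c x y} := by
    rw [← (summable_inner x y).tsum_const_smul]
    simp
  star_inner x y := by
    rw [tsum_star]
    simp
  norm_eq_sqrt_norm_inner_self x := rfl

instance : NormedAddCommGroup (HilbertSum B E) :=
  NormedAddCommGroup.ofCore (CStarModule.normedSpaceCore B)

instance : NormedSpace ℂ (HilbertSum B E) :=
  NormedSpace.ofCore (CStarModule.normedSpaceCore B)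

theorem inner_def (x y : HilbertSum B E) :
    inner B x y = ∑' i, inner B (x.coord i) (y.coord i) := rfl

end HilbertSum

end DirectSum

section AdjointPairs

variable {B : Type*} [NonUnitalCStarAlgebra B] [PartialOrder B] [StarOrderedRing B]
variable {E : Type*} [NormedAddCommGroup E] [NormedSpace ℂ E] [SMul B E] [CStarModule B E]
variable {F : Type*} [NormedAddCommGroup F] [NormedSpace ℂ F] [SMul B F] [CStarModule B F]

theorem inner_le_of_adjoint [CompleteSpace E] (C : E →L[ℂ] F) (D : F →L[ℂ] E)
    (h : ∀ x y, inner B (C x) y = inner B x (D y)) (x : E) :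
    inner B (C x) (C x) ≤ (‖D‖ * ‖C‖) • inner B x x := by
  have h' : ∀ x y, inner B (D x) y = inner B x (C y) := fun x y => by
    rw [← CStarModule.star_inner, ← h, CStarModule.star_inner]
  let T : Adjointable B E := ⟨D ∘L C, D ∘L C, fun x y => by simp [h, h']⟩
  have hT : IsSelfAdjoint T := star_eq_of fun x y => by simp [T, h, h']
  let _ := CStarAlgebra.spectralOrder (Adjointable B E)
  have := CStarAlgebra.spectralOrderedRing (Adjointable B E)
  have h0 := sub_nonneg.mpr (IsSelfAdjoint.le_algebraMap_norm_self hT)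
  obtain ⟨R, hR⟩ := CStarAlgebra.nonneg_iff_eq_star_mul_self.mp h0
  have h1 : (0 : B) ≤ inner B (R.1 x) (R.1 x) := CStarModule.inner_self_nonneg
  have h2 : (star R).1 (R.1 x) = ((‖T‖ : ℝ) : ℂ) • x - D (C x) := by
    change (star R * R).1 x = _
    rw [← hR, Algebra.algebraMap_eq_smul_one,
      show ‖T‖ • (1 : Adjointable B E) = ((‖T‖ : ℝ) : ℂ) • 1 from (Complex.coe_smul _ _).symm]
    rfl
  rw [inner_apply_left, h2, CStarModule.inner_sub_right, ← h, sub_nonneg,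
    CStarModule.inner_smul_right_complex] at h1
  refine h1.trans ?_
  rw [show ((‖T‖ : ℝ) : ℂ) • inner B x x = ‖T‖ • inner B x x from Complex.coe_smul _ _]
  exact smul_le_smul_of_nonneg_right (ContinuousLinearMap.opNorm_comp_le D C)
    CStarModule.inner_self_nonneg

end AdjointPairs

open scoped RightActions

section ProductSystems

variable {A : Type*} [NonUnitalCStarAlgebra A] [PartialOrder A] [StarOrderedRing A]

variable (A) in
/-- The `A`-valued inner product `⟪x, y⟫` of a right Hilbert `A`-module. In the convention of
`CStarModule` a right Hilbert `A`-module is a `CStarModule` over `Aᵐᵒᵖ`; it is linear in the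
second variable and satisfies `⟪x, y a⟫ = ⟪x, y⟫ a`. -/
abbrev rip {E : Type*} [NormedAddCommGroup E] [NormedSpace ℂ E] [SMul Aᵐᵒᵖ E]
    [CStarModule Aᵐᵒᵖ E] (x y : E) : A := unop (inner Aᵐᵒᵖ x y)

variable (A) in
/-- A product system over the monoid `P` with coefficients in the C⋆-algebra `A`.

The fibres are right Hilbert `A`-modules `X p`, with a left action of `A` by adjointable
operators. The multiplication maps are given as bilinear maps `X p × X q → X r` for `p q = r`
(so that associativity can be stated without transport); `inner_mul` and `dense_mul` say exactly
that they induce unitaries `X p ⊗_A X q ≅ X r` from the interior tensor product. For `p = 1`,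
`dense_mul` together with `one_mul` is the nondegeneracy of the left action on `X q`. -/
structure ProductSystem (P : Type*) [Monoid P] (X : P → Type*)
    [∀ p, NormedAddCommGroup (X p)] [∀ p, NormedSpace ℂ (X p)] [∀ p, SMul Aᵐᵒᵖ (X p)]
    [∀ p, CStarModule Aᵐᵒᵖ (X p)] where
  /-- The left action `φ_p : A → L(X p)`. -/
  leftAct (p : P) : A →⋆ₙₐ[ℂ] Adjointable Aᵐᵒᵖ (X p)
  /-- The identification of `X e` with the standard bimodule `A`. -/
  coeff : A ≃ₗ[ℂ] X 1
  rip_coeff (a b : A) : rip A (coeff a) (coeff b) = star a * b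
  leftAct_coeff (a b : A) : (leftAct 1 a).1 (coeff b) = coeff (a * b)
  coeff_smul (a b : A) : coeff a <• b = coeff (a * b)
  /-- The multiplication maps. -/
  mul {p q r : P} (h : p * q = r) : X p →ₗ[ℂ] X q →ₗ[ℂ] X r
  mul_balanced {p q r : P} (h : p * q = r) (x : X p) (a : A) (y : X q) :
    mul h (x <• a) y = mul h x ((leftAct q a).1 y)
  leftAct_mul {p q r : P} (h : p * q = r) (a : A) (x : X p) (y : X q) :
    (leftAct r a).1 (mul h x y) = mul h ((leftAct p a).1 x) y
  mul_smul {p q r : P} (h : p * q = r) (x : X p) (y : X q) (a : A) :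
    mul h x y <• a = mul h x (y <• a)
  rip_mul {p q r : P} (h : p * q = r) (x x' : X p) (y y' : X q) :
    rip A (mul h x y) (mul h x' y') = rip A y ((leftAct q (rip A x x')).1 y')
  dense_mul {p q r : P} (h : p * q = r) :
    Dense (Submodule.span ℂ {z : X r | ∃ x y, z = mul h x y} : Set (X r))
  one_mul {q : P} (h : 1 * q = q) (a : A) (y : X q) : mul h (coeff a) y = (leftAct q a).1 y
  mul_one {p : P} (h : p * 1 = p) (x : X p) (a : A) : mul h x (coeff a) = x <• a
  mul_assoc {p q r pq qr pqr : P} (h₁ : p * q = pq) (h₂ : pq * r = pqr) (h₃ : q * r = qr)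
    (h₄ : p * qr = pqr) (x : X p) (y : X q) (z : X r) :
    mul h₂ (mul h₁ x y) z = mul h₄ x (mul h₃ y z)

namespace ProductSystem

variable {P : Type*} [Monoid P] {X : P → Type*}
  [∀ p, NormedAddCommGroup (X p)] [∀ p, NormedSpace ℂ (X p)] [∀ p, SMul Aᵐᵒᵖ (X p)]
  [∀ p, CStarModule Aᵐᵒᵖ (X p)]
variable (S : ProductSystem A P X)

/-- The multiplication `X p ⊗ X q → X r` on the algebraic tensor product. -/
def mulMap {p q r : P} (h : p * q = r) : X p ⊗[ℂ] X q →ₗ[ℂ] X r := TensorProduct.lift (S.mul h)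

theorem inner_mul {p q r : P} (h : p * q = r) (x x' : X p) (y y' : X q) :
    inner Aᵐᵒᵖ (S.mul h x y) (S.mul h x' y') =
      inner Aᵐᵒᵖ y ((S.leftAct q (rip A x x')).1 y') :=
  unop_injective (S.rip_mul h x x' y y')

theorem mulMap_isBalanced {p q r : P} (h : p * q = r) :
    IsBalanced Aᵐᵒᵖ Aᵐᵒᵖ (S.mulMap h) := by
  intro T x y v w
  simp only [mulMap, TensorProduct.lift.tmul]
  rw [S.inner_mul, S.inner_mul, rip, inner_apply_left]

theorem denseRange_mulMap {p q r : P} (h : p * q = r) : DenseRange (S.mulMap h) := by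
  refine (S.dense_mul h).mono ?_
  intro z hz
  have : Submodule.span ℂ {z : X r | ∃ x y, z = S.mul h x y} ≤ LinearMap.range (S.mulMap h) := by
    refine Submodule.span_le.mpr ?_
    rintro _ ⟨x, y, rfl⟩
    exact ⟨x ⊗ₜ y, rfl⟩
  exact this hz

variable [∀ p, CompleteSpace (X p)]

/-- The map `i_p^r : L(X p) → L(X r)`, `r = p q`, with `i_p^r(T)(x y) = (T x) y`. -/
def amplify {p q r : P} (h : p * q = r) (T : Adjointable Aᵐᵒᵖ (X p)) : Adjointable Aᵐᵒᵖ (X r) :=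
  extendAct (S.mulMap h) (S.mulMap_isBalanced h) (S.denseRange_mulMap h) T

theorem amplify_mul {p q r : P} (h : p * q = r) (T : Adjointable Aᵐᵒᵖ (X p)) (x : X p) (y : X q) :
    (S.amplify h T).1 (S.mul h x y) = S.mul h (T.1 x) y :=
  extendAct_apply (S.mulMap h) (S.mulMap_isBalanced h) (S.denseRange_mulMap h) T x y

/-- Left multiplication by `x ∈ X p`, as a bounded map `X q → X r`, `r = p q`. -/
def creation {p q r : P} (h : p * q = r) (x : X p) : X q →L[ℂ] X r :=
  LinearMap.mkContinuous (S.mul h x) ‖x‖ (fun y => by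
    refine le_of_sq_le_sq ?_ (by positivity)
    rw [CStarModule.norm_sq_eq Aᵐᵒᵖ, S.inner_mul]
    calc ‖inner Aᵐᵒᵖ y ((S.leftAct q (rip A x x)).1 y)‖
        ≤ ‖y‖ * ‖(S.leftAct q (rip A x x)).1 y‖ := CStarModule.norm_inner_le _
      _ ≤ ‖y‖ * (‖rip A x x‖ * ‖y‖) := by
          gcongr
          refine ((S.leftAct q (rip A x x)).1.le_opNorm y).trans ?_
          gcongr
          exact NonUnitalStarAlgHom.norm_apply_le (S.leftAct q) (rip A x x)
      _ = (‖x‖ * ‖y‖) ^ 2 := by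
          have : ‖rip A x x‖ = ‖x‖ ^ 2 := by
            rw [CStarModule.norm_sq_eq Aᵐᵒᵖ]; rfl
          rw [this]; ring)

theorem creation_apply {p q r : P} (h : p * q = r) (x : X p) (y : X q) :
    S.creation h x y = S.mul h x y := rfl

theorem norm_creation_le {p q r : P} (h : p * q = r) (x : X p) : ‖S.creation h x‖ ≤ ‖x‖ :=
  LinearMap.mkContinuous_norm_le _ (norm_nonneg _) _

/-- `x' ⊗ y ↦ φ_q(⟪x, x'⟫) y`. -/
def annihilationAux {p : P} (q : P) (x : X p) : X p ⊗[ℂ] X q →ₗ[ℂ] X q :=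
  TensorProduct.lift (LinearMap.mk₂ ℂ (fun x' y => (S.leftAct q (rip A x x')).1 y)
    (fun a b y => by simp [rip])
    (fun c a y => by simp [rip])
    (fun a y z => by simp)
    (fun c a y => by simp))

theorem inner_annihilationAux {p q r : P} (h : p * q = r) (x : X p) (y : X q)
    (u : X p ⊗[ℂ] X q) :
    inner Aᵐᵒᵖ (S.mul h x y) (S.mulMap h u) = inner Aᵐᵒᵖ y (S.annihilationAux q x u) := by
  induction u with
  | zero => simp
  | add a b ha hb => simp [ha, hb]
  | tmul a b => exact S.inner_mul h x a y b

theorem norm_annihilationAux_le {p q r : P} (h : p * q = r) (x : X p) (u : X p ⊗[ℂ] X q) :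
    ‖S.annihilationAux q x u‖ ≤ ‖x‖ * ‖S.mulMap h u‖ := by
  refine norm_le_of_inner_le Aᵐᵒᵖ _ _ (by positivity) ?_
  rw [← S.inner_annihilationAux h]
  calc _ ≤ ‖S.mul h x (S.annihilationAux q x u)‖ * ‖S.mulMap h u‖ := CStarModule.norm_inner_le _
    _ ≤ (‖x‖ * ‖S.annihilationAux q x u‖) * ‖S.mulMap h u‖ := by
        gcongr
        exact (S.creation h x).le_of_opNorm_le (S.norm_creation_le h x) _
    _ = _ := by ring

/-- The adjoint `X r → X q` of left multiplication by `x ∈ X p`, `r = p q`; it maps `x' y` to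
`φ_q(⟪x, x'⟫) y`. -/
def annihilation {p q r : P} (h : p * q = r) (x : X p) : X r →L[ℂ] X q :=
  (S.annihilationAux q x).extendOfNorm (S.mulMap h)

theorem norm_annihilation_le {p q r : P} (h : p * q = r) (x : X p) :
    ‖S.annihilation h x‖ ≤ ‖x‖ :=
  LinearMap.opNorm_extendOfNorm_le (S.denseRange_mulMap h) (norm_nonneg _)
    (S.norm_annihilationAux_le h x)

theorem inner_creation {p q r : P} (h : p * q = r) (x : X p) (y : X q) (z : X r) :
    inner Aᵐᵒᵖ (S.creation h x y) z = inner Aᵐᵒᵖ y (S.annihilation h x z) := by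
  refine (S.denseRange_mulMap h).induction_on (p := fun z =>
    inner Aᵐᵒᵖ (S.creation h x y) z = inner Aᵐᵒᵖ y (S.annihilation h x z)) z ?_ fun u => ?_
  · refine isClosed_eq ?_ ?_
    · exact (CStarModule.continuous_inner (A := Aᵐᵒᵖ) (E := X r)).comp
        (continuous_const.prodMk continuous_id)
    · exact (CStarModule.continuous_inner (A := Aᵐᵒᵖ) (E := X q)).comp
        (continuous_const.prodMk (ContinuousLinearMap.continuous _))
  · rw [creation_apply, S.inner_annihilationAux h]
    congr 1
    exact (LinearMap.extendOfNorm_eq (S.denseRange_mulMap h)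
      ⟨‖x‖, S.norm_annihilationAux_le h x⟩ u).symm

theorem inner_creation_le {p q r : P} (h : p * q = r) (x : X p) (y : X q) :
    inner Aᵐᵒᵖ (S.mul h x y) (S.mul h x y) ≤ (‖x‖ ^ 2) • inner Aᵐᵒᵖ y y := by
  refine (inner_le_of_adjoint _ _ (S.inner_creation h x) y).trans ?_
  refine smul_le_smul_of_nonneg_right ?_ CStarModule.inner_self_nonneg
  rw [sq]
  exact mul_le_mul (S.norm_annihilation_le h x) (S.norm_creation_le h x) (norm_nonneg _)
    (norm_nonneg _)

theorem inner_annihilation_le {p q r : P} (h : p * q = r) (x : X p) (z : X r) :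
    inner Aᵐᵒᵖ (S.annihilation h x z) (S.annihilation h x z) ≤ (‖x‖ ^ 2) • inner Aᵐᵒᵖ z z := by
  refine (inner_le_of_adjoint _ (S.creation h x) (fun a b => ?_) z).trans ?_
  · rw [← CStarModule.star_inner, ← S.inner_creation, CStarModule.star_inner]
  refine smul_le_smul_of_nonneg_right ?_ CStarModule.inner_self_nonneg
  rw [sq]
  exact mul_le_mul (S.norm_creation_le h x) (S.norm_annihilation_le h x) (norm_nonneg _)
    (norm_nonneg _)

end ProductSystem

end ProductSystems

section OperatorAlgebras

variable {H : Type*} [NormedAddCommGroup H] [InnerProductSpace ℂ H] [CompleteSpace H]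
variable {K : Type*} [NormedAddCommGroup K] [InnerProductSpace ℂ K] [CompleteSpace K]

variable (H K) in
/-- The Hilbert space tensor product: the completion of the algebraic tensor product for the
inner product `⟪h ⊗ k, h' ⊗ k'⟫ = ⟪h, h'⟫ ⟪k, k'⟫`. -/
abbrev HilbertTensor : Type _ := UniformSpace.Completion (H ⊗[ℂ] K)

/-- The operator `S ⊗ T` on `H ⊗ K`. -/
def opTensor (S : H →L[ℂ] H) (T : K →L[ℂ] K) : HilbertTensor H K →L[ℂ] HilbertTensor H K :=
  (TensorProduct.mapL S T).completion

theorem opTensor_apply (S : H →L[ℂ] H) (T : K →L[ℂ] K) (h : H) (k : K) :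
    opTensor S T ((h ⊗ₜ[ℂ] k : H ⊗[ℂ] K) : HilbertTensor H K) =
      ((S h ⊗ₜ[ℂ] T k : H ⊗[ℂ] K) : HilbertTensor H K) := by
  simp [opTensor]

/-- The C⋆-algebra generated by a set of operators on a Hilbert space. -/
def cstarGen (s : Set (H →L[ℂ] H)) : NonUnitalStarSubalgebra ℂ (H →L[ℂ] H) :=
  (NonUnitalStarAlgebra.adjoin ℂ s).topologicalClosure

/-- The spatial (minimal) tensor product of two concrete C⋆-algebras. -/
def spatialTensor (C : NonUnitalStarSubalgebra ℂ (H →L[ℂ] H))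
    (D : NonUnitalStarSubalgebra ℂ (K →L[ℂ] K)) :
    NonUnitalStarSubalgebra ℂ (HilbertTensor H K →L[ℂ] HilbertTensor H K) :=
  cstarGen {T | ∃ c ∈ C, ∃ d ∈ D, T = opTensor c d}

end OperatorAlgebras

section RegularRepresentation

/-- `ℓ²(P)`. -/
abbrev ell2 (P : Type*) : Type _ := lp (fun _ : P => ℂ) 2

open scoped Classical in
/-- The basis vector `e_r` of `ℓ²(P)`. -/
def basisVec {P : Type*} (r : P) : ell2 P := lp.single 2 r (1 : ℂ)

open scoped Classical in
/-- The isometry `c ↦ c e_r`. -/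
def basisIsometry {P : Type*} (r : P) : ℂ →ₗᵢ[ℂ] ell2 P where
  toLinearMap := lp.lsingle (𝕜 := ℂ) (E := fun _ : P => ℂ) 2 r
  norm_map' x := lp.norm_single (E := fun _ : P => ℂ) (by norm_num) r x

variable {P : Type*} [Monoid P] [IsLeftCancelMul P]

theorem orthogonalFamily_mul (p : P) :
    OrthogonalFamily ℂ (fun _ : P => ℂ) (fun r => basisIsometry (p * r)) := by
  classical
  intro r s hrs x y
  have h : p * r ≠ p * s := fun h => hrs (mul_left_cancel h)
  have e : inner ℂ (lp.single (E := fun _ : P => ℂ) 2 (p * r) x)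
      (lp.single (E := fun _ : P => ℂ) 2 (p * s) y) = 0 := by
    rw [lp.inner_single_left, lp.single_apply, Pi.single_apply, if_neg h, inner_zero_right]
  exact e

/-- The left regular representation of `P`: the shift `V_p e_r = e_{pr}` on `ℓ²(P)`. -/
def shift (p : P) : ell2 P →L[ℂ] ell2 P :=
  (orthogonalFamily_mul p).linearIsometry.toContinuousLinearMap

theorem shift_basisVec (p r : P) : shift p (basisVec r) = basisVec (p * r) := by
  classical
  have := (orthogonalFamily_mul p).linearIsometry_apply_single (i := r) (1 : ℂ)
  exact this

variable (P) in
/-- `C*_λ(P)`: the C⋆-algebra generated by the left regular representation. -/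
def regularCStar : NonUnitalStarSubalgebra ℂ (ell2 P →L[ℂ] ell2 P) :=
  cstarGen (Set.range shift)

theorem shift_mem (p : P) : shift p ∈ regularCStar P :=
  NonUnitalStarSubalgebra.le_topologicalClosure _
    (NonUnitalStarAlgebra.subset_adjoin ℂ _ ⟨p, rfl⟩)

end RegularRepresentation

section Fock

variable {A : Type*} [NonUnitalCStarAlgebra A] [PartialOrder A] [StarOrderedRing A]

namespace ProductSystem

variable {P : Type*} [Monoid P] [IsLeftCancelMul P] {X : P → Type*}
  [∀ p, NormedAddCommGroup (X p)] [∀ p, NormedSpace ℂ (X p)] [∀ p, SMul Aᵐᵒᵖ (X p)]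
  [∀ p, CStarModule Aᵐᵒᵖ (X p)] [∀ p, CompleteSpace (X p)]
variable (S : ProductSystem A P X)

open scoped Classical in
/-- The family with `s`-th entry `x y_r` if `s = p r`, and `0` if `s ∉ pP`. -/
def fockFun {p : P} (x : X p) (y : ∀ r, X r) (s : P) : X s :=
  if h : ∃ r, p * r = s then S.mul h.choose_spec x (y h.choose) else 0

theorem fockFun_mul {p : P} (x : X p) (y : ∀ r, X r) {r s : P} (h : p * r = s) :
    S.fockFun x y s = S.mul h x (y r) := by
  have h' : ∃ r, p * r = s := ⟨r, h⟩
  have key : ∀ r' (h₁ : p * r' = s), S.mul h₁ x (y r') = S.mul h x (y r) := by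
    intro r' h₁
    obtain rfl : r' = r := mul_left_cancel (h₁.trans h.symm)
    rfl
  rw [fockFun, dif_pos h']
  exact key _ _

theorem fockFun_of_notMem {p : P} (x : X p) (y : ∀ r, X r) {s : P}
    (h : s ∉ Set.range (fun r => p * r)) : S.fockFun x y s = 0 := dif_neg h

variable (X) in
/-- The Fock space `F(X) = ⨁ X_r`. -/
abbrev FockSpace : Type _ := HilbertSum Aᵐᵒᵖ X

theorem fockFun_summable {p : P} (x : X p) (y : FockSpace (A := A) X) :
    Summable fun s => inner Aᵐᵒᵖ (S.fockFun x y.coord s) (S.fockFun x y.coord s) := by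
  rw [← (mul_right_injective p).summable_iff (f := fun s =>
    inner Aᵐᵒᵖ (S.fockFun x y.coord s) (S.fockFun x y.coord s))
    (fun s hs => by rw [S.fockFun_of_notMem x _ hs]; simp)]
  refine summable_of_le (fun r => CStarModule.inner_self_nonneg) (fun r => ?_)
    (y.summable_self.const_smul (‖x‖ ^ 2))
  simp only [Function.comp]
  rw [S.fockFun_mul x _ rfl]
  exact S.inner_creation_le rfl x _

/-- The creation operator on the Fock space, as a linear map. -/
def fockLin {p : P} (x : X p) : FockSpace (A := A) X →ₗ[ℂ] FockSpace (A := A) X where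
  toFun y := HilbertSum.mk (S.fockFun x y.coord) (S.fockFun_summable x y)
  map_add' y z := HilbertSum.ext fun s => by
    by_cases h : ∃ r, p * r = s
    · obtain ⟨r, h⟩ := h
      simp [S.fockFun_mul x _ h]
    · simp [fockFun, h]
  map_smul' c y := HilbertSum.ext fun s => by
    by_cases h : ∃ r, p * r = s
    · obtain ⟨r, h⟩ := h
      simp [S.fockFun_mul x _ h]
    · simp [fockFun, h]

theorem fockLin_coord {p r s : P} (h : p * r = s) (x : X p) (y : FockSpace (A := A) X) :
    (S.fockLin x y).coord s = S.mul h x (y.coord r) := S.fockFun_mul x _ h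

theorem fockLin_coord_of_notMem {p s : P} (h : s ∉ Set.range (fun r => p * r)) (x : X p)
    (y : FockSpace (A := A) X) : (S.fockLin x y).coord s = 0 := S.fockFun_of_notMem x _ h

theorem inner_fockLin {p : P} (x : X p) (y z : FockSpace (A := A) X) :
    inner Aᵐᵒᵖ (S.fockLin x y) z =
      ∑' r, inner Aᵐᵒᵖ (S.mul (r := p * r) rfl x (y.coord r)) (z.coord (p * r)) := by
  rw [HilbertSum.inner_def, ← (mul_right_injective p).tsum_eq (f := fun s =>
    inner Aᵐᵒᵖ ((S.fockLin x y).coord s) (z.coord s))]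
  · exact tsum_congr fun r => by rw [S.fockLin_coord rfl]
  · intro s hs
    by_contra h
    exact hs (by simp [S.fockLin_coord_of_notMem h])

theorem norm_fockLin_le {p : P} (x : X p) (y : FockSpace (A := A) X) :
    ‖S.fockLin x y‖ ≤ ‖x‖ * ‖y‖ := by
  refine le_of_sq_le_sq ?_ (by positivity)
  rw [CStarModule.norm_sq_eq Aᵐᵒᵖ, mul_pow, CStarModule.norm_sq_eq Aᵐᵒᵖ (x := y), inner_fockLin,
    HilbertSum.inner_def]
  have hs : Summable fun r => inner Aᵐᵒᵖ (S.mul (r := p * r) rfl x (y.coord r))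
      ((S.fockLin x y).coord (p * r)) := by
    have := (S.fockFun_summable x y).comp_injective (mul_right_injective p)
    refine this.congr fun r => ?_
    simp only [Function.comp]
    rw [S.fockFun_mul x _ rfl, S.fockLin_coord rfl]
  calc _ ≤ ‖∑' r, (‖x‖ ^ 2) • inner Aᵐᵒᵖ (y.coord r) (y.coord r)‖ := by
        refine CStarAlgebra.norm_le_norm_of_nonneg_of_le (tsum_nonneg fun r => ?_)
          (hs.tsum_le_tsum (fun r => ?_) (y.summable_self.const_smul _))
        · rw [S.fockLin_coord rfl]; exact CStarModule.inner_self_nonneg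
        · rw [S.fockLin_coord rfl]; exact S.inner_creation_le rfl x _
    _ = _ := by
        rw [y.summable_self.tsum_const_smul, norm_smul]; simp

/-- The adjoint of the creation operator on the Fock space, as a linear map. -/
def fockAdjLin {p : P} (x : X p) : FockSpace (A := A) X →ₗ[ℂ] FockSpace (A := A) X where
  toFun z := HilbertSum.mk (fun r => S.annihilation (r := p * r) rfl x (z.coord (p * r)))
    (summable_of_le (fun r => CStarModule.inner_self_nonneg)
      (fun r => S.inner_annihilation_le rfl x _)
      ((z.summable_self.comp_injective (mul_right_injective p)).const_smul (‖x‖ ^ 2)))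
  map_add' y z := HilbertSum.ext fun s => by simp
  map_smul' c y := HilbertSum.ext fun s => by simp

theorem inner_fockLin_adj {p : P} (x : X p) (y z : FockSpace (A := A) X) :
    inner Aᵐᵒᵖ (S.fockLin x y) z = inner Aᵐᵒᵖ y (S.fockAdjLin x z) := by
  rw [inner_fockLin, HilbertSum.inner_def]
  exact tsum_congr fun r => S.inner_creation rfl x _ _

theorem norm_fockAdjLin_le {p : P} (x : X p) (z : FockSpace (A := A) X) :
    ‖S.fockAdjLin x z‖ ≤ ‖x‖ * ‖z‖ := by
  refine norm_le_of_inner_le Aᵐᵒᵖ _ _ (by positivity) ?_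
  rw [← inner_fockLin_adj]
  calc _ ≤ ‖S.fockLin x (S.fockAdjLin x z)‖ * ‖z‖ := CStarModule.norm_inner_le _
    _ ≤ (‖x‖ * ‖S.fockAdjLin x z‖) * ‖z‖ := by gcongr; exact S.norm_fockLin_le x _
    _ = _ := by ring

/-- The Fock representation: the adjointable operator on `F(X)` with `y_r ↦ x y_r` for `x ∈ X p`
and `y_r ∈ X r`. -/
def fock {p : P} (x : X p) : Adjointable Aᵐᵒᵖ (FockSpace (A := A) X) :=
  ⟨(S.fockLin x).mkContinuous ‖x‖ (S.norm_fockLin_le x),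
    (S.fockAdjLin x).mkContinuous ‖x‖ (S.norm_fockAdjLin_le x), S.inner_fockLin_adj x⟩

theorem fock_coord {p r s : P} (h : p * r = s) (x : X p) (y : FockSpace (A := A) X) :
    ((S.fock x).1 y).coord s = S.mul h x (y.coord r) := S.fockLin_coord h x y

theorem fock_coord_of_notMem {p s : P} (h : s ∉ Set.range (fun r => p * r)) (x : X p)
    (y : FockSpace (A := A) X) : ((S.fock x).1 y).coord s = 0 := S.fockLin_coord_of_notMem h x y

/-- The Fock algebra `T_λ(X)`: the C⋆-algebra generated by the Fock representation in the
adjointable operators on the Fock space. -/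
def fockAlgebra : NonUnitalStarSubalgebra ℂ (Adjointable Aᵐᵒᵖ (FockSpace (A := A) X)) :=
  (NonUnitalStarAlgebra.adjoin ℂ {T | ∃ (p : P) (x : X p), T = S.fock x}).topologicalClosure

theorem fock_mem {p : P} (x : X p) : S.fock x ∈ S.fockAlgebra :=
  NonUnitalStarSubalgebra.le_topologicalClosure _
    (NonUnitalStarAlgebra.subset_adjoin ℂ _ ⟨p, x, rfl⟩)

end ProductSystem

end Fock

section Representations

variable {A : Type*} [NonUnitalCStarAlgebra A] [PartialOrder A] [StarOrderedRing A]

/-- The principal right ideal `pP`. -/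
def rightIdeal {P : Type*} [Monoid P] (p : P) : Set P := Set.range fun r => p * r

/-- Clifford's condition: if `pP ∩ qP` is nonempty then it is of the form `wP`. -/
def IsRightLCM (P : Type*) [Monoid P] : Prop :=
  ∀ p q : P, (rightIdeal p ∩ rightIdeal q).Nonempty →
    ∃ w : P, rightIdeal p ∩ rightIdeal q = rightIdeal w

namespace ProductSystem

variable {P : Type*} [Monoid P] {X : P → Type*}
  [∀ p, NormedAddCommGroup (X p)] [∀ p, NormedSpace ℂ (X p)] [∀ p, SMul Aᵐᵒᵖ (X p)]
  [∀ p, CStarModule Aᵐᵒᵖ (X p)] [∀ p, CompleteSpace (X p)]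
variable (S : ProductSystem A P X)

/-- Compact alignment: `i_p^w(k_p) i_q^w(k_q) ∈ K(X w)` whenever `pP ∩ qP = wP`, for
`k_p ∈ K(X p)` and `k_q ∈ K(X q)`. Here `w = p p' = q q'`. -/
def IsCompactlyAligned : Prop :=
  ∀ {p q w p' q' : P} (_ : rightIdeal p ∩ rightIdeal q = rightIdeal w)
    (hp : p * p' = w) (hq : q * q' = w)
    (k : Compacts Aᵐᵒᵖ (X p)) (l : Compacts Aᵐᵒᵖ (X q)),
    S.amplify hp k.1 * S.amplify hq l.1 ∈ Compacts Aᵐᵒᵖ (X w)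

/-- A Toeplitz representation of the product system on the Hilbert space `H`. -/
structure ToeplitzRep (H : Type*) [NormedAddCommGroup H] [InnerProductSpace ℂ H]
    [CompleteSpace H] where
  /-- The maps `t_p : X p → B(H)`. -/
  toFun (p : P) : X p →ₗ[ℂ] (H →L[ℂ] H)
  map_star (a : A) : toFun 1 (S.coeff (star a)) = star (toFun 1 (S.coeff a))
  map_rip {p : P} (x y : X p) : toFun 1 (S.coeff (rip A x y)) = star (toFun p x) * toFun p y
  map_mul {p q r : P} (h : p * q = r) (x : X p) (y : X q) :
    toFun p x * toFun q y = toFun r (S.mul h x y)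

namespace ToeplitzRep

variable {S} {H : Type*} [NormedAddCommGroup H] [InnerProductSpace ℂ H] [CompleteSpace H]
variable (t : S.ToeplitzRep H)

/-- The representation `t_p : K(X p) → B(H)` with `θ_{x,y} ↦ t_p(x) t_p(y)*`. -/
def onCompacts (p : P) : Compacts Aᵐᵒᵖ (X p) →L[ℂ] (H →L[ℂ] H) := inducedRep Aᵐᵒᵖ (t.toFun p)

theorem onCompacts_rankOne {p : P} (x y : X p) :
    t.onCompacts p ⟨rankOne Aᵐᵒᵖ x y, rankOne_mem x y⟩ = t.toFun p x * star (t.toFun p y) :=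
  inducedRep_rankOne (t.toFun p) (fun b => t.toFun 1 (S.coeff (unop b)))
    (fun x y => t.map_rip x y)
    (fun b x => by rw [t.map_mul (_root_.mul_one p), S.mul_one, op_unop]) x y

/-- `t` is injective if `t_e` is. -/
def IsInjective : Prop := Function.Injective (t.toFun 1)

/-- Nica covariance: for `k_p ∈ K(X p)` and `k_q ∈ K(X q)`, `t_p(k_p) t_q(k_q)` is
`t_w(i_p^w(k_p) i_q^w(k_q))` if `pP ∩ qP = wP`, and `0` if `pP ∩ qP = ∅`. -/
def IsNicaCovariant (hS : S.IsCompactlyAligned) : Prop :=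
  (∀ {p q w p' q' : P} (hw : rightIdeal p ∩ rightIdeal q = rightIdeal w)
    (hp : p * p' = w) (hq : q * q' = w)
    (k : Compacts Aᵐᵒᵖ (X p)) (l : Compacts Aᵐᵒᵖ (X q)),
    t.onCompacts p k * t.onCompacts q l =
      t.onCompacts w ⟨S.amplify hp k.1 * S.amplify hq l.1, hS hw hp hq k l⟩) ∧
  (∀ {p q : P}, rightIdeal p ∩ rightIdeal q = ∅ →
    ∀ (k : Compacts Aᵐᵒᵖ (X p)) (l : Compacts Aᵐᵒᵖ (X q)),
      t.onCompacts p k * t.onCompacts q l = 0)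

/-- `C*(t)`: the C⋆-algebra generated by the representation. -/
def cstar : NonUnitalStarSubalgebra ℂ (H →L[ℂ] H) :=
  cstarGen {T | ∃ (p : P) (x : X p), T = t.toFun p x}

theorem mem_cstar {p : P} (x : X p) : t.toFun p x ∈ t.cstar :=
  NonUnitalStarSubalgebra.le_topologicalClosure _
    (NonUnitalStarAlgebra.subset_adjoin ℂ _ ⟨p, x, rfl⟩)

end ToeplitzRep

end ProductSystem

end Representations

end ProdSys

end

open ProdSys

/-! Consider the C⋆-algebra generated by the pairs of a Fock operator and the corresponding operator
$t_p(\xi)\otimes V_p$ (`fellGraph`). A closed star subalgebra of a product that meets both factors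
trivially is the graph of an injective homomorphism (`exists_starHom_of_graph`), so it suffices to
show that in such a pair one coordinate vanishes exactly when the other does.

The two coordinates are linked by the maps `fockEval`, one for each $h\in H$, sending $(y_r)$ to
$\sum_r t_r(y_r)h\otimes e_r$. Together they embed $F(X)\otimes_A H$ isometrically into
$H\otimes\ell^2(P)$, with image $\bigoplus_r [t_r(X_r)H]\otimes e_r$, and they intertwine the
coordinates of every pair and their adjoints (`fellGraph_le_intertwinedPairs`). If the second
coordinate is zero and the first is $T$, then $t_e(\langle Ty,Ty\rangle)=0$ for all $y$, and
injectivity of $t_e$ gives $T=0$ (`fst_eq_zero_of_mem_intertwinedPairs`).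

Conversely, if the first coordinate is zero, the second, $b$, vanishes on each $[t_s(X_s)H]\otimes
e_s$. These subspaces need not exhaust $H\otimes\ell^2(P)$, and Nica covariance is what forces $b=0$
(`eq_zero_of_fockEval`). It makes the closed span of the $t_p(x)t_q(y)^*\otimes V_pV_q^*$ an algebra
(`adjoin_le_fellSpan`), so $b^*b$ is a limit of finite sums of such terms. Right cancellation shows
that only terms with $p=q$ reach the diagonal: the $r$-th diagonal entry of a finite sum is $\sum
T_p$ over the $p$ with $r\in pP$, where $T_p\in[t_p(X_p)t_p(X_p)^*]$ (`exists_diagEntry_eq`).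

The projections onto the subspaces $[t_p(X_p)H]$ for these $p$ commute with the $T_q$ and cut $H$
into orthogonal pieces. On a piece inside the ranges for $p\in D$ and orthogonal to the others, only
the terms from $D$ survive. For nonempty $D$ the piece lies in $[t_w(X_w)H]$ for a common multiple
$w$ of $D$ dividing $r$, where the sum agrees with the $w$-th diagonal entry. Diagonal entries are
therefore controlled on all of $H$ by their restrictions to the $[t_s(X_s)H]$ (`norm_sum_apply_le`),
and those of $b^*b$ vanish there. A positive operator with zero diagonal is zero. -/

noncomputable section

namespace ProdSys

/-! ### Approximate factorization in a Hilbert module. -/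

section HilbertModuleFacts

variable {B : Type*} [NonUnitalCStarAlgebra B] [PartialOrder B] [StarOrderedRing B]
variable {E : Type*} [NormedAddCommGroup E] [NormedSpace ℂ E] [SMul B E] [CStarModule B E]

/-- The elements of the form `⟪d x, x⟫ x` approximate `x`. -/
theorem exists_inner_smul_near (x : E) {ε : ℝ} (hε : 0 < ε) :
    ∃ d : B, ‖x - inner B (d • x) x • x‖ ≤ ε := by
  set a : B := inner B x x with ha
  have hsa : IsSelfAdjoint a := CStarModule.isSelfAdjoint_inner_self
  -- With $g(s)=s/(s^2+\eta^2)$ and $d=g(a)$, the coefficient is $c=ag(a)$, a smoothed support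
  -- projection of $a$. Then $1-sg(s)=\eta^2/(s^2+\eta^2)$, so $\|x-cx\|^2$ is at most the supremum
  -- of $|s|\eta^4/(s^2+\eta^2)^2\le\eta=\varepsilon^2$.
  set η : ℝ := ε ^ 2 with hη
  have hη0 : 0 < η := by positivity
  have hpos : ∀ s : ℝ, 0 < s ^ 2 + η ^ 2 := fun s => by positivity
  let g : ℝ → ℝ := fun s => s / (s ^ 2 + η ^ 2)
  have hg : Continuous g := by
    refine continuous_id.div (by fun_prop) fun s => (hpos s).ne'
  let d : B := cfcₙ g a
  have hd : star d = d := (cfcₙ_predicate (R := ℝ) g a : IsSelfAdjoint _)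
  let c : B := inner B (d • x) x
  have hc : c = a * d := by
    simp only [c, CStarModule.inner_op_smul_left, hd]; rfl
  have hid : a = cfcₙ (fun s : ℝ => s) a := (cfcₙ_id' ℝ a).symm
  have hc' : c = cfcₙ (fun s : ℝ => s * g s) a := by
    rw [hc, cfcₙ_mul (fun s : ℝ => s) g a (by fun_prop) (by simp) hg.continuousOn (by simp [g]),
      ← hid]
  have hcs : star c = c := by
    rw [hc']; exact (cfcₙ_predicate (R := ℝ) _ a : IsSelfAdjoint _)
  have hgs : Continuous fun s : ℝ => s * g s := continuous_id.mul hg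
  refine ⟨d, ?_⟩
  change ‖x - c • x‖ ≤ ε
  -- The function is $s(1-sg(s))^2$, written out without the constant $1$ because the calculus is
  -- non-unital.
  have key : inner B (x - c • x) (x - c • x) =
      cfcₙ (fun s : ℝ => (s - s * g s * s) - (s * (s * g s) - s * g s * s * (s * g s))) a := by
    rw [cfcₙ_sub _ _ a (by fun_prop) (by simp) (by fun_prop) (by simp),
      cfcₙ_sub _ _ a (by fun_prop) (by simp) (by fun_prop) (by simp),
      cfcₙ_sub _ _ a (by fun_prop) (by simp) (by fun_prop) (by simp),
      cfcₙ_mul (fun s : ℝ => s * g s * s) (fun s : ℝ => s * g s) a (by fun_prop) (by simp)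
        (by fun_prop) (by simp),
      cfcₙ_mul (fun s : ℝ => s * g s) (fun s : ℝ => s) a (by fun_prop) (by simp)
        (by fun_prop) (by simp),
      cfcₙ_mul (fun s : ℝ => s) (fun s : ℝ => s * g s) a (by fun_prop) (by simp)
        (by fun_prop) (by simp), ← hid, ← hc']
    simp only [CStarModule.inner_sub_left, CStarModule.inner_sub_right,
      CStarModule.inner_op_smul_left, CStarModule.inner_op_smul_right, hcs, ← ha]
    noncomm_ring
  have hn : ‖x - c • x‖ ^ 2 ≤ ε ^ 2 := by
    rw [CStarModule.norm_sq_eq B, key, ← hη]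
    refine norm_cfcₙ_le fun s _ => ?_
    have e : (s - s * g s * s) - (s * (s * g s) - s * g s * s * (s * g s)) =
        s * (η ^ 2 / (s ^ 2 + η ^ 2)) ^ 2 := by
      have := (hpos s).ne'
      simp only [g]; field_simp; ring
    rw [e, Real.norm_eq_abs, abs_mul, abs_of_nonneg (sq_nonneg (η ^ 2 / (s ^ 2 + η ^ 2))),
      div_pow, ← mul_div_assoc, div_le_iff₀ (by have := hpos s; positivity)]
    have h1 : 2 * (|s| * η) ≤ s ^ 2 + η ^ 2 := by
      have := sq_nonneg (|s| - η); rw [← sq_abs s]; nlinarith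
    have h2 : η ^ 2 ≤ s ^ 2 + η ^ 2 := by nlinarith [sq_nonneg s]
    have h3 : |s| * η * η ^ 2 ≤ (s ^ 2 + η ^ 2) * (s ^ 2 + η ^ 2) := by
      have : 0 ≤ |s| * η := by positivity
      exact mul_le_mul (by linarith) h2 (by positivity) (hpos s).le
    nlinarith
  exact le_of_sq_le_sq hn hε.le

end HilbertModuleFacts

/-! ### Completeness of the Hilbert module direct sum. -/

section DirectSumComplete

variable {B : Type*} [NonUnitalCStarAlgebra B] [PartialOrder B] [StarOrderedRing B]
variable {ι : Type*} {E : ι → Type*} [∀ i, NormedAddCommGroup (E i)] [∀ i, NormedSpace ℂ (E i)]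
  [∀ i, SMul B (E i)] [∀ i, CStarModule B (E i)]

namespace HilbertSum

@[simp] theorem coord_sub (x y : HilbertSum B E) (i : ι) :
    (x - y).coord i = x.coord i - y.coord i := rfl

theorem norm_sum_inner_le (x : HilbertSum B E) (F : Finset ι) :
    ‖∑ i ∈ F, inner B (x.coord i) (x.coord i)‖ ≤ ‖x‖ ^ 2 := by
  rw [CStarModule.norm_sq_eq B, inner_def]
  exact CStarAlgebra.norm_le_norm_of_nonneg_of_le
    (Finset.sum_nonneg fun i _ => CStarModule.inner_self_nonneg)
    (x.summable_self.sum_le_tsum F fun i _ => CStarModule.inner_self_nonneg)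

theorem norm_coord_le (x : HilbertSum B E) (i : ι) : ‖x.coord i‖ ≤ ‖x‖ := by
  have h := norm_sum_inner_le x {i}
  rw [Finset.sum_singleton, ← CStarModule.norm_sq_eq B] at h
  exact le_of_sq_le_sq h (norm_nonneg x)

/-- The parallelogram law for $y$ and $y-x$: the difference of the two sides is $\langle
2y-x,2y-x\rangle\ge 0$. -/
theorem inner_self_le_two_smul (i : ι) (x y : E i) :
    inner B x x ≤ (2 : ℝ) • inner B y y + (2 : ℝ) • inner B (y - x) (y - x) := by
  have h : (0 : B) ≤ inner B ((y - x) + y) ((y - x) + y) := CStarModule.inner_self_nonneg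
  refine sub_nonneg.mp (h.trans_eq ?_)
  simp only [CStarModule.inner_sub_left, CStarModule.inner_sub_right,
    CStarModule.inner_add_left, CStarModule.inner_add_right]
  module

/-- Makes the adjointable operators on the Fock space a C⋆-algebra. As for $\ell^2$, a Cauchy
sequence converges in each coordinate, and bounds on finite partial sums that are uniform in the
finite set pass to the coordinatewise limit. -/
instance [∀ i, CompleteSpace (E i)] : CompleteSpace (HilbertSum B E) := by
  refine Metric.complete_of_cauchySeq_tendsto fun u hu => ?_
  have hcoord : ∀ i, ∃ z, Filter.Tendsto (fun n => (u n).coord i) Filter.atTop (nhds z) := by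
    intro i
    refine cauchySeq_tendsto_of_complete ?_
    rw [Metric.cauchySeq_iff] at hu ⊢
    intro ε hε
    obtain ⟨N, hN⟩ := hu ε hε
    refine ⟨N, fun m hm n hn => lt_of_le_of_lt ?_ (hN m hm n hn)⟩
    rw [dist_eq_norm, dist_eq_norm, ← coord_sub]
    exact norm_coord_le _ i
  choose y hy using hcoord
  have hfin : ∀ ε > 0, ∃ N, ∀ n ≥ N, ∀ F : Finset ι,
      ‖∑ i ∈ F, inner B ((u n).coord i - y i) ((u n).coord i - y i)‖ ≤ ε ^ 2 := by
    intro ε hε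
    obtain ⟨N, hN⟩ := Metric.cauchySeq_iff.mp hu ε hε
    refine ⟨N, fun n hn F => ?_⟩
    have ht : Filter.Tendsto (fun m => ‖∑ i ∈ F, inner B ((u n - u m).coord i)
        ((u n - u m).coord i)‖) Filter.atTop
        (nhds ‖∑ i ∈ F, inner B ((u n).coord i - y i) ((u n).coord i - y i)‖) := by
      refine (tendsto_finsetSum _ fun i _ => ?_).norm
      have h1 : Filter.Tendsto (fun m => (u n - u m).coord i) Filter.atTop
          (nhds ((u n).coord i - y i)) := tendsto_const_nhds.sub (hy i)
      exact ((CStarModule.continuous_inner (A := B) (E := E i)).tendsto _).comp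
        (h1.prodMk_nhds h1)
    refine le_of_tendsto ht ?_
    filter_upwards [Filter.eventually_ge_atTop N] with m hm
    refine (norm_sum_inner_le _ F).trans ?_
    have := (hN n hn m hm).le
    rw [dist_eq_norm] at this
    gcongr
  have hys : Summable fun i => inner B (y i) (y i) := by
    rw [summable_iff_vanishing_norm]
    intro ε hε
    -- The square root makes the bound on the partial sums $\varepsilon/8$; the two errors, each
    -- doubled by `inner_self_le_two_smul`, then total less than $\varepsilon$.
    obtain ⟨N, hN⟩ := hfin (√(ε / 8)) (by positivity)
    rw [Real.sq_sqrt (by positivity)] at hN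
    obtain ⟨s, hs⟩ := summable_iff_vanishing_norm.mp (u N).summable_self (ε / 8) (by positivity)
    refine ⟨s, fun F hF => ?_⟩
    calc ‖∑ i ∈ F, inner B (y i) (y i)‖
        ≤ ‖(2 : ℝ) • ∑ i ∈ F, inner B ((u N).coord i) ((u N).coord i) +
          (2 : ℝ) • ∑ i ∈ F, inner B ((u N).coord i - y i) ((u N).coord i - y i)‖ := by
          refine CStarAlgebra.norm_le_norm_of_nonneg_of_le
            (Finset.sum_nonneg fun i _ => CStarModule.inner_self_nonneg) ?_
          rw [Finset.smul_sum, Finset.smul_sum, ← Finset.sum_add_distrib]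
          exact Finset.sum_le_sum fun i _ => inner_self_le_two_smul i _ _
      _ ≤ 2 * ‖∑ i ∈ F, inner B ((u N).coord i) ((u N).coord i)‖ +
          2 * ‖∑ i ∈ F, inner B ((u N).coord i - y i) ((u N).coord i - y i)‖ := by
          refine (norm_add_le _ _).trans ?_
          simp [norm_smul]
      _ < ε := by
          have h1 := hs F hF
          have h2 := hN N le_rfl F
          linarith
  refine ⟨mk y hys, ?_⟩
  rw [Metric.tendsto_atTop]
  intro ε hε
  obtain ⟨N, hN⟩ := hfin (ε / 2) (by positivity)
  refine ⟨N, fun n hn => ?_⟩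
  rw [dist_eq_norm]
  refine lt_of_le_of_lt (le_of_sq_le_sq (b := ε / 2) ?_ (by positivity)) (by linarith)
  rw [CStarModule.norm_sq_eq B]
  have hsum : HasSum _ (inner B (u n - mk y hys) (u n - mk y hys)) :=
    (u n - mk y hys).summable_self.hasSum
  exact le_of_tendsto hsum.norm (Filter.Eventually.of_forall fun F => hN n hn F)

end HilbertSum

end DirectSumComplete

/-! ### Operators on the Hilbert space tensor product. -/

section OperatorTensor

variable {H : Type*} [NormedAddCommGroup H] [InnerProductSpace ℂ H] [CompleteSpace H]
variable {K : Type*} [NormedAddCommGroup K] [InnerProductSpace ℂ K] [CompleteSpace K]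

theorem HilbertTensor.ext_tmul {M : Type*} [NormedAddCommGroup M] [NormedSpace ℂ M]
    {a b : HilbertTensor H K →L[ℂ] M}
    (h : ∀ (x : H) (k : K), a ((x ⊗ₜ[ℂ] k : H ⊗[ℂ] K) : HilbertTensor H K) =
      b ((x ⊗ₜ[ℂ] k : H ⊗[ℂ] K) : HilbertTensor H K)) : a = b := by
  ext z
  induction z using UniformSpace.Completion.induction_on with
  | hp => exact isClosed_eq a.continuous b.continuous
  | ih u =>
    induction u with
    | zero => rw [UniformSpace.Completion.coe_zero, map_zero, map_zero]
    | add u v hu hv => rw [UniformSpace.Completion.coe_add, map_add, map_add, hu, hv]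
    | tmul x k => exact h x k

theorem star_opTensor (S : H →L[ℂ] H) (T : K →L[ℂ] K) :
    star (opTensor S T) = opTensor (star S) (star T) := by
  refine HilbertTensor.ext_tmul fun x k => ext_inner_left ℂ fun z => ?_
  rw [ContinuousLinearMap.star_eq_adjoint, ContinuousLinearMap.adjoint_inner_right]
  induction z using UniformSpace.Completion.induction_on with
  | hp => exact isClosed_eq (by fun_prop) (by fun_prop)
  | ih u =>
    induction u with
    | zero => rw [UniformSpace.Completion.coe_zero, inner_zero_left, map_zero, inner_zero_left]
    | add u v hu hv => simp only [UniformSpace.Completion.coe_add, map_add, inner_add_left, hu, hv]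
    | tmul y l =>
      rw [opTensor_apply, opTensor_apply, UniformSpace.Completion.inner_coe,
        UniformSpace.Completion.inner_coe, TensorProduct.inner_tmul, TensorProduct.inner_tmul,
        ContinuousLinearMap.star_eq_adjoint, ContinuousLinearMap.star_eq_adjoint,
        ContinuousLinearMap.adjoint_inner_right, ContinuousLinearMap.adjoint_inner_right]

theorem norm_opTensor_le (S : H →L[ℂ] H) (T : K →L[ℂ] K) : ‖opTensor S T‖ ≤ ‖S‖ * ‖T‖ := by
  refine ContinuousLinearMap.opNorm_le_bound _ (by positivity) fun z => ?_
  induction z using UniformSpace.Completion.induction_on with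
  | hp => exact isClosed_le (by fun_prop) (by fun_prop)
  | ih u =>
    rw [opTensor, ContinuousLinearMap.completion_apply_coe, UniformSpace.Completion.norm_coe,
      UniformSpace.Completion.norm_coe]
    exact (TensorProduct.mapL S T).le_of_opNorm_le (TensorProduct.norm_mapL_le S T) u

variable (H K) in
/-- The Hilbert space tensor product as an opaque type, so that its operators carry only the
instances that come from its Hilbert space structure. -/
def TensorSpace : Type _ := HilbertTensor H K

instance : NormedAddCommGroup (TensorSpace H K) :=
  inferInstanceAs (NormedAddCommGroup (HilbertTensor H K))

instance : InnerProductSpace ℂ (TensorSpace H K) :=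
  inferInstanceAs (InnerProductSpace ℂ (HilbertTensor H K))

instance : CompleteSpace (TensorSpace H K) :=
  inferInstanceAs (CompleteSpace (HilbertTensor H K))

/-- The elementary tensor `h ⊗ k`, linear in `h` and continuous in `k`. -/
def elemTensor (h : H) : K →L[ℂ] TensorSpace H K :=
  (UniformSpace.Completion.toComplL ∘L TensorProduct.mkL ℂ H K h : K →L[ℂ] HilbertTensor H K)

theorem elemTensor_add (h h' : H) (k : K) :
    elemTensor (h + h') k = elemTensor h k + elemTensor h' k := by
  change (((h + h') ⊗ₜ[ℂ] k : H ⊗[ℂ] K) : HilbertTensor H K) = _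
  rw [TensorProduct.add_tmul, UniformSpace.Completion.coe_add]; rfl

theorem elemTensor_smul (c : ℂ) (h : H) (k : K) :
    elemTensor (c • h) k = c • elemTensor h k := by
  change (((c • h) ⊗ₜ[ℂ] k : H ⊗[ℂ] K) : HilbertTensor H K) = _
  rw [← TensorProduct.smul_tmul', UniformSpace.Completion.coe_smul]; rfl

theorem inner_elemTensor (h h' : H) (k k' : K) :
    inner ℂ (elemTensor h k) (elemTensor h' k') = inner ℂ h h' * inner ℂ k k' := by
  change inner ℂ ((h ⊗ₜ[ℂ] k : H ⊗[ℂ] K) : HilbertTensor H K)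
    ((h' ⊗ₜ[ℂ] k' : H ⊗[ℂ] K) : HilbertTensor H K) = _
  rw [UniformSpace.Completion.inner_coe, TensorProduct.inner_tmul]

theorem norm_elemTensor (h : H) (k : K) : ‖elemTensor h k‖ = ‖h‖ * ‖k‖ := by
  change ‖((h ⊗ₜ[ℂ] k : H ⊗[ℂ] K) : HilbertTensor H K)‖ = _
  rw [UniformSpace.Completion.norm_coe, TensorProduct.norm_tmul]

theorem ext_elemTensor {M : Type*} [NormedAddCommGroup M] [NormedSpace ℂ M]
    {a b : TensorSpace H K →L[ℂ] M}
    (h : ∀ (x : H) (k : K), a (elemTensor x k) = b (elemTensor x k)) : a = b :=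
  HilbertTensor.ext_tmul (H := H) (K := K) h

/-- The operator `S ⊗ T`. -/
def tensorOp (S : H →L[ℂ] H) (T : K →L[ℂ] K) : TensorSpace H K →L[ℂ] TensorSpace H K :=
  opTensor S T

theorem tensorOp_apply (S : H →L[ℂ] H) (T : K →L[ℂ] K) (h : H) (k : K) :
    tensorOp S T (elemTensor h k) = elemTensor (S h) (T k) := opTensor_apply S T h k

theorem tensorOp_mul (S S' : H →L[ℂ] H) (T T' : K →L[ℂ] K) :
    tensorOp S T * tensorOp S' T' = tensorOp (S * S') (T * T') :=
  ext_elemTensor fun x k => by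
    rw [mul_apply_eq_comp, tensorOp_apply, tensorOp_apply, tensorOp_apply]; rfl

theorem star_tensorOp (S : H →L[ℂ] H) (T : K →L[ℂ] K) :
    star (tensorOp S T) = tensorOp (star S) (star T) := star_opTensor S T

/-- `S ↦ S ⊗ T`. -/
def tensorOpLeft (T : K →L[ℂ] K) :
    (H →L[ℂ] H) →L[ℂ] (TensorSpace H K →L[ℂ] TensorSpace H K) :=
  LinearMap.mkContinuous
    { toFun := fun S => tensorOp S T
      map_add' := fun S S' => ext_elemTensor fun x k => by
        simp only [add_apply, tensorOp_apply, elemTensor_add]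
      map_smul' := fun c S => ext_elemTensor fun x k => by
        simp only [smul_apply, tensorOp_apply, elemTensor_smul, RingHom.id_apply] }
    ‖T‖ (fun S => (norm_opTensor_le S T).trans_eq (mul_comm _ _))

end OperatorTensor

/-! ### The slices $H\otimes e_r$ and the diagonal entries of operators on $H\otimes\ell^2(P)$. -/

section Slices

variable {H : Type*} [NormedAddCommGroup H] [InnerProductSpace ℂ H] [CompleteSpace H]
variable {P : Type*}

theorem inner_basisVec (r s : P) [Decidable (r = s)] :
    inner ℂ (basisVec r) (basisVec s) = if r = s then (1 : ℂ) else 0 := by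
  classical
  rw [basisVec, basisVec, lp.inner_single_left, lp.single_apply, Pi.single_apply]
  split_ifs <;> simp

/-- The isometry `h ↦ h ⊗ e_r`. -/
def slice (r : P) : H →ₗᵢ[ℂ] TensorSpace H (ell2 P) where
  toFun h := elemTensor h (basisVec r)
  map_add' h k := elemTensor_add h k _
  map_smul' c h := elemTensor_smul c h _
  norm_map' h := by
    classical
    have : ‖basisVec r‖ = 1 := by
      rw [basisVec, lp.norm_single (by norm_num), norm_one]
    change ‖elemTensor h (basisVec r)‖ = ‖h‖
    rw [norm_elemTensor, this, mul_one]

theorem slice_apply (r : P) (h : H) : slice r h = elemTensor h (basisVec r) := rfl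

theorem inner_slice (r : P) (h k : H) :
    inner ℂ (slice r h) (slice r k) = inner ℂ h k := (slice r).inner_map_map h k

theorem inner_slice_of_ne {r s : P} (hrs : r ≠ s) (h k : H) :
    inner ℂ (slice r h) (slice s k) = 0 := by
  classical
  rw [slice_apply, slice_apply, inner_elemTensor, inner_basisVec, if_neg hrs, mul_zero]

theorem ext_basisVec {M : Type*} [NormedAddCommGroup M] [NormedSpace ℂ M] {a b : ell2 P →L[ℂ] M}
    (h : ∀ r, a (basisVec r) = b (basisVec r)) : a = b := by
  classical
  ext1 l
  have hs := lp.hasSum_single (E := fun _ : P => ℂ) (by norm_num : (2 : ENNReal) ≠ ⊤) l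
  rw [← (hs.mapL a).tsum_eq, ← (hs.mapL b).tsum_eq]
  refine tsum_congr fun r => ?_
  have e : lp.single (E := fun _ : P => ℂ) 2 r (l r) = (l r) • basisVec r := by
    rw [basisVec, ← lp.single_smul]; simp
  rw [e, map_smul, map_smul, h]

theorem ext_slice {M : Type*} [NormedAddCommGroup M] [NormedSpace ℂ M]
    {a b : TensorSpace H (ell2 P) →L[ℂ] M} (h : ∀ r x, a (slice r x) = b (slice r x)) :
    a = b := by
  refine ext_elemTensor fun x k => ?_
  have : a ∘L elemTensor x = b ∘L elemTensor x := ext_basisVec fun r => h r x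
  exact DFunLike.congr_fun this k

theorem tensorOp_slice {S : H →L[ℂ] H} {T : ell2 P →L[ℂ] ell2 P} {r s : P}
    (h : T (basisVec r) = basisVec s) (x : H) : tensorOp S T (slice r x) = slice s (S x) := by
  rw [slice_apply, tensorOp_apply, h, slice_apply]

theorem tensorOp_slice_of_eq_zero {S : H →L[ℂ] H} {T : ell2 P →L[ℂ] ell2 P} {r : P}
    (h : T (basisVec r) = 0) (x : H) : tensorOp S T (slice r x) = 0 := by
  rw [slice_apply, tensorOp_apply, h, map_zero]

/-- The diagonal entry `a_r` of an operator on `H ⊗ ℓ²(P)`. -/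
def diagEntry (r : P) (a : TensorSpace H (ell2 P) →L[ℂ] TensorSpace H (ell2 P)) :
    H →L[ℂ] H :=
  ContinuousLinearMap.adjoint (slice r).toContinuousLinearMap ∘L a ∘L
    (slice r).toContinuousLinearMap

theorem inner_diagEntry (r : P)
    (a : TensorSpace H (ell2 P) →L[ℂ] TensorSpace H (ell2 P)) (h k : H) :
    inner ℂ h (diagEntry r a k) = inner ℂ (slice r h) (a (slice r k)) :=
  by
  rw [diagEntry, ContinuousLinearMap.comp_apply, ContinuousLinearMap.adjoint_inner_right]; rfl

theorem diagEntry_add (r : P) (a b : TensorSpace H (ell2 P) →L[ℂ] TensorSpace H (ell2 P)) :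
    diagEntry r (a + b) = diagEntry r a + diagEntry r b := by ext; simp [diagEntry]

theorem diagEntry_sub (r : P) (a b : TensorSpace H (ell2 P) →L[ℂ] TensorSpace H (ell2 P)) :
    diagEntry r (a - b) = diagEntry r a - diagEntry r b := by ext; simp [diagEntry]

theorem diagEntry_smul (r : P) (c : ℂ)
    (a : TensorSpace H (ell2 P) →L[ℂ] TensorSpace H (ell2 P)) :
    diagEntry r (c • a) = c • diagEntry r a := by ext; simp [diagEntry]

theorem norm_diagEntry_apply_le (r : P)
    (a : TensorSpace H (ell2 P) →L[ℂ] TensorSpace H (ell2 P)) (h : H) :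
    ‖diagEntry r a h‖ ≤ ‖a (slice r h)‖ := by
  have h1 : ‖ContinuousLinearMap.adjoint (slice (H := H) r).toContinuousLinearMap‖ ≤ 1 := by
    rw [LinearIsometryEquiv.norm_map]
    exact (slice r).norm_toContinuousLinearMap_le
  calc _ ≤ 1 * ‖a (slice r h)‖ := ContinuousLinearMap.le_of_opNorm_le _ h1 _
    _ = _ := one_mul _

theorem diagEntry_tensorOp {S : H →L[ℂ] H} {T : ell2 P →L[ℂ] ell2 P} {r : P}
    (h : T (basisVec r) = basisVec r) : diagEntry r (tensorOp S T) = S := by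
  ext x
  refine ext_inner_left ℂ fun z => ?_
  rw [inner_diagEntry, tensorOp_slice h, inner_slice]

theorem diagEntry_tensorOp_eq_zero {S : H →L[ℂ] H} {T : ell2 P →L[ℂ] ell2 P} {r : P}
    (h : T (basisVec r) = 0 ∨ ∃ s, s ≠ r ∧ T (basisVec r) = basisVec s) :
    diagEntry r (tensorOp S T) = 0 := by
  ext x
  refine ext_inner_left ℂ fun z => ?_
  rw [inner_diagEntry]
  rcases h with h | ⟨s, hs, h⟩
  · rw [tensorOp_slice_of_eq_zero h]; simp
  · rw [tensorOp_slice h, inner_slice_of_ne hs.symm]; simp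

/-- Faithfulness of taking the diagonal: $\langle x,(b^*b)_r x\rangle=\|b(x\otimes e_r)\|^2$, and
the slices span a dense subspace. -/
theorem eq_zero_of_diagEntry_star_mul_self
    {b : TensorSpace H (ell2 P) →L[ℂ] TensorSpace H (ell2 P)}
    (h : ∀ r, diagEntry r (star b * b) = 0) : b = 0 := by
  refine ext_slice fun r x => ?_
  have h1 := inner_diagEntry r (star b * b) x x
  rw [h r, mul_apply_eq_comp, ContinuousLinearMap.star_eq_adjoint,
    ContinuousLinearMap.adjoint_inner_right] at h1
  simpa using h1.symm

end Slices

/-! ### Relations in the left regular representation of a right LCM monoid. -/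

section Shifts

variable {P : Type*} [Monoid P] [IsLeftCancelMul P]

theorem star_shift_basisVec_mul (p r : P) : star (shift p) (basisVec (p * r)) = basisVec r := by
  have : star (shift p) * shift p = 1 := by
    ext1 x
    refine ext_inner_left ℂ fun y => ?_
    rw [mul_apply_eq_comp, ContinuousLinearMap.star_eq_adjoint,
      ContinuousLinearMap.adjoint_inner_right]
    exact (orthogonalFamily_mul p).linearIsometry.inner_map_map y x
  rw [← shift_basisVec, ← mul_apply_eq_comp, this]; rfl

theorem star_shift_basisVec_of_notMem {p s : P} (h : s ∉ rightIdeal p) :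
    star (shift p) (basisVec s) = 0 := by
  classical
  have e : (innerSL ℂ (star (shift p) (basisVec s)) : ell2 P →L[ℂ] ℂ) = 0 := by
    refine ext_basisVec fun r => ?_
    rw [innerSL_apply_apply, ContinuousLinearMap.star_eq_adjoint,
      ContinuousLinearMap.adjoint_inner_left, shift_basisVec, inner_basisVec,
      if_neg (fun h' => h ⟨r, h'.symm⟩), zero_apply]
  have := DFunLike.congr_fun e (star (shift p) (basisVec s))
  rw [innerSL_apply_apply, zero_apply] at this
  exact inner_self_eq_zero.mp this

theorem shift_mul (p q : P) : shift p * shift q = shift (p * q) :=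
  ext_basisVec fun r => by
    rw [mul_apply_eq_comp, shift_basisVec, shift_basisVec, shift_basisVec, mul_assoc]

theorem star_shift_mul_shift_of_disjoint {p q : P} (h : rightIdeal q ∩ rightIdeal p = ∅) :
    star (shift q) * shift p = 0 :=
  ext_basisVec fun r => by
    rw [mul_apply_eq_comp, shift_basisVec]
    exact star_shift_basisVec_of_notMem fun h' =>
      (h ▸ (⟨h', r, rfl⟩ : p * r ∈ rightIdeal q ∩ rightIdeal p) : p * r ∈ (∅ : Set P))

/-- The vector $V_q^*V_pe_r$ is nonzero exactly when $pr\in qP\cap pP=wP$, that is, by left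
cancellation, when $r=p'z$ for some $z$; then $pr=wz=qq'z$ and both sides give $e_{q'z}$. -/
theorem star_shift_mul_shift {p q w p' q' : P} (h : rightIdeal q ∩ rightIdeal p = rightIdeal w)
    (hp : p * p' = w) (hq : q * q' = w) :
    star (shift q) * shift p = shift q' * star (shift p') :=
  ext_basisVec fun r => by
    rw [mul_apply_eq_comp, shift_basisVec, mul_apply_eq_comp]
    by_cases hr : p * r ∈ rightIdeal q
    · have : p * r ∈ rightIdeal w := h ▸ ⟨hr, r, rfl⟩
      obtain ⟨z, hz⟩ := this
      have e1 : r = p' * z := mul_left_cancel (a := p) (by rw [← hz, ← hp]; exact mul_assoc p p' z)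
      have e2 : p * r = q * (q' * z) := by
        rw [← hz, ← hq]; exact mul_assoc q q' z
      rw [e2, star_shift_basisVec_mul, e1, star_shift_basisVec_mul, shift_basisVec]
    · rw [star_shift_basisVec_of_notMem hr, star_shift_basisVec_of_notMem, map_zero]
      rintro ⟨z, rfl⟩
      exact hr ⟨q' * z, by simp only [← mul_assoc, hp, hq]⟩

end Shifts

/-- Semilinear maps are allowed so that the involution is covered as well as multiplications and
evaluations. -/
theorem map_mem_of_mem_closure_span {E F : Type*} [NormedAddCommGroup E] [NormedSpace ℂ E]
    [NormedAddCommGroup F] [NormedSpace ℂ F] {σ : ℂ →+* ℂ} (f : E →SL[σ] F) {s : Set E}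
    {N : Submodule ℂ F} (hN : IsClosed (N : Set F)) (h : ∀ a ∈ s, f a ∈ N) {a : E}
    (ha : a ∈ (Submodule.span ℂ s).topologicalClosure) : f a ∈ N := by
  have hc : IsClosed ((N.comap f.toLinearMap : Submodule ℂ E) : Set E) := hN.preimage f.continuous
  have hs : Submodule.span ℂ s ≤ N.comap f.toLinearMap := Submodule.span_le.mpr h
  exact Submodule.topologicalClosure_minimal _ hs hc ha

theorem mul_mem_of_mem_closure_span {R : Type*} [NormedRing R] [NormedAlgebra ℂ R] {s s' : Set R}
    {N : Submodule ℂ R} (hN : IsClosed (N : Set R)) (h : ∀ a ∈ s, ∀ b ∈ s', a * b ∈ N) {a b : R}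
    (ha : a ∈ (Submodule.span ℂ s).topologicalClosure)
    (hb : b ∈ (Submodule.span ℂ s').topologicalClosure) : a * b ∈ N :=
  map_mem_of_mem_closure_span (ContinuousLinearMap.mul ℂ R a) hN (fun b hb =>
    map_mem_of_mem_closure_span ((ContinuousLinearMap.mul ℂ R).flip b) hN
      (fun a ha => h a ha b hb) ha) hb

theorem mem_closure_inner_smul {B : Type*} [NonUnitalCStarAlgebra B] [PartialOrder B]
    [StarOrderedRing B] {E : Type*} [NormedAddCommGroup E] [NormedSpace ℂ E] [SMul B E]
    [CStarModule B E] (x : E) : x ∈ closure {z | ∃ y : E, z = inner B y x • x} := by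
  refine Metric.mem_closure_iff.mpr fun ε hε => ?_
  obtain ⟨d, hd⟩ := exists_inner_smul_near (B := B) x (half_pos hε)
  refine ⟨_, ⟨d • x, rfl⟩, ?_⟩
  rw [dist_eq_norm]
  linarith

/-! ### Toeplitz representations: the spaces $[t_p(X_p)t_q(X_q)^*]$, the subspaces $[t_p(X_p)H]$,
and covariance. -/

section RepFacts

variable {A : Type*} [NonUnitalCStarAlgebra A] [PartialOrder A] [StarOrderedRing A]
variable {P : Type*} [Monoid P] {X : P → Type*}
  [∀ p, NormedAddCommGroup (X p)] [∀ p, NormedSpace ℂ (X p)] [∀ p, SMul Aᵐᵒᵖ (X p)]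
  [∀ p, CStarModule Aᵐᵒᵖ (X p)] [∀ p, CompleteSpace (X p)]
variable {S : ProductSystem A P X}

open scoped RightActions

theorem ProductSystem.annihilation_mul (S : ProductSystem A P X) {p q r : P} (h : p * q = r)
    (x x' : X p) (y : X q) :
    S.annihilation h x (S.mul h x' y) = (S.leftAct q (rip A x x')).1 y :=
  LinearMap.extendOfNorm_eq (S.denseRange_mulMap h)
    ⟨‖x‖, S.norm_annihilationAux_le h x⟩ (x' ⊗ₜ y)

namespace ProductSystem.ToeplitzRep

variable {H : Type*} [NormedAddCommGroup H] [InnerProductSpace ℂ H] [CompleteSpace H]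
variable (t : S.ToeplitzRep H)

/-- The representation of the coefficient algebra. -/
def coeffHom : A →⋆ₙₐ[ℂ] (H →L[ℂ] H) where
  toFun a := t.toFun 1 (S.coeff a)
  map_smul' c a := by simp
  map_zero' := by simp
  map_add' a b := by simp
  map_mul' a b := by
    rw [t.map_mul (_root_.mul_one 1), S.mul_one, S.coeff_smul]
  map_star' a := t.map_star a

theorem coeffHom_apply (a : A) : t.coeffHom a = t.toFun 1 (S.coeff a) := rfl

theorem star_mul_self_eq {p : P} (x y : X p) :
    star (t.toFun p x) * t.toFun p y = t.coeffHom (rip A x y) := (t.map_rip x y).symm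

theorem mul_coeffHom {p : P} (x : X p) (a : A) :
    t.toFun p x * t.coeffHom a = t.toFun p (x <• a) := by
  rw [coeffHom_apply, t.map_mul (_root_.mul_one p), S.mul_one]

theorem coeffHom_mul {p : P} (a : A) (x : X p) :
    t.coeffHom a * t.toFun p x = t.toFun p ((S.leftAct p a).1 x) := by
  rw [coeffHom_apply, t.map_mul (_root_.one_mul p), S.one_mul]

theorem norm_coeffHom_le (a : A) : ‖t.coeffHom a‖ ≤ ‖a‖ :=
  NonUnitalStarAlgHom.norm_apply_le t.coeffHom a

theorem norm_toFun_le {p : P} (x : X p) : ‖t.toFun p x‖ ≤ ‖x‖ := by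
  refine le_of_sq_le_sq ?_ (norm_nonneg _)
  rw [sq, ← CStarRing.norm_star_mul_self, t.star_mul_self_eq, CStarModule.norm_sq_eq Aᵐᵒᵖ]
  exact t.norm_coeffHom_le _

/-- The maps `t_p`, as continuous linear maps. -/
def toCLM (p : P) : X p →L[ℂ] (H →L[ℂ] H) :=
  (t.toFun p).mkContinuous 1 fun x => by rw [_root_.one_mul]; exact t.norm_toFun_le x

/-- On a product $u=ab$ this is $t_p(x)^*t_p(a)t_q(b)=t_e(\langle x,a\rangle)t_q(b)$; such products
span a dense subspace of $X_r$ and both sides are continuous in $u$. -/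
theorem star_toFun_mul_toFun {p q r : P} (h : p * q = r) (x : X p) (u : X r) :
    star (t.toFun p x) * t.toFun r u = t.toFun q (S.annihilation h x u) := by
  refine (S.denseRange_mulMap h).induction_on (p := fun u =>
    star (t.toFun p x) * t.toFun r u = t.toFun q (S.annihilation h x u)) u ?_ fun v => ?_
  · exact isClosed_eq (continuous_const.mul (t.toCLM r).continuous)
      ((t.toCLM q).continuous.comp (ContinuousLinearMap.continuous _))
  · induction v with
    | zero => simp
    | add a b ha hb => simp only [map_add, mul_add, ha, hb]
    | tmul a b =>
      simp only [mulMap, TensorProduct.lift.tmul]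
      rw [← t.map_mul h, ← _root_.mul_assoc, t.star_mul_self_eq, t.coeffHom_mul,
        S.annihilation_mul]

/-- The closed linear span of the operators `t_p(x) t_q(y)*`. -/
def mixedSpan (p q : P) : Submodule ℂ (H →L[ℂ] H) :=
  (Submodule.span ℂ {T | ∃ (x : X p) (y : X q), T = t.toFun p x * star (t.toFun q y)}).topologicalClosure

theorem isClosed_mixedSpan (p q : P) : IsClosed (t.mixedSpan p q : Set (H →L[ℂ] H)) :=
  Submodule.isClosed_topologicalClosure _

theorem mem_mixedSpan {p q : P} (x : X p) (y : X q) :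
    t.toFun p x * star (t.toFun q y) ∈ t.mixedSpan p q :=
  Submodule.le_topologicalClosure _ (Submodule.subset_span ⟨x, y, rfl⟩)

theorem star_mem_mixedSpan {p q : P} {T : H →L[ℂ] H} (hT : T ∈ t.mixedSpan p q) :
    star T ∈ t.mixedSpan q p := by
  refine map_mem_of_mem_closure_span (starL ℂ : (H →L[ℂ] H) ≃L⋆[ℂ] (H →L[ℂ] H)).toContinuousLinearMap
    (t.isClosed_mixedSpan q p) ?_ hT
  rintro _ ⟨x, y, rfl⟩
  change star (t.toFun p x * star (t.toFun q y)) ∈ _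
  rw [star_mul, star_star]
  exact t.mem_mixedSpan y x

theorem mul_mem_mixedSpan {p q r : P} {T T' : H →L[ℂ] H} (hT : T ∈ t.mixedSpan p q)
    (hT' : T' ∈ t.mixedSpan q r) : T * T' ∈ t.mixedSpan p r := by
  refine mul_mem_of_mem_closure_span (t.isClosed_mixedSpan p r) ?_ hT hT'
  rintro _ ⟨x, y, rfl⟩ _ ⟨x', y', rfl⟩
  rw [_root_.mul_assoc, ← _root_.mul_assoc (star _), t.star_mul_self_eq, ← _root_.mul_assoc,
    t.mul_coeffHom]
  exact t.mem_mixedSpan _ _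

/-- The closed linear span of the vectors `t_p(x) h`. -/
def essSpace (p : P) : Submodule ℂ H :=
  (Submodule.span ℂ {v | ∃ (x : X p) (h : H), v = t.toFun p x h}).topologicalClosure

theorem isClosed_essSpace (p : P) : IsClosed (t.essSpace p : Set H) :=
  Submodule.isClosed_topologicalClosure _

instance (p : P) : CompleteSpace (t.essSpace p) := (t.isClosed_essSpace p).completeSpace_coe

theorem toFun_apply_mem_essSpace {p : P} (x : X p) (h : H) : t.toFun p x h ∈ t.essSpace p :=
  Submodule.le_topologicalClosure _ (Submodule.subset_span ⟨x, h, rfl⟩)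

theorem apply_mem_essSpace {p q : P} {T : H →L[ℂ] H} (hT : T ∈ t.mixedSpan p q) (h : H) :
    T h ∈ t.essSpace p := by
  refine map_mem_of_mem_closure_span (ContinuousLinearMap.apply ℂ H h) (t.isClosed_essSpace p) ?_ hT
  rintro _ ⟨x, y, rfl⟩
  exact t.toFun_apply_mem_essSpace _ _

theorem apply_eq_zero_of_mem_orthogonal {p q : P} {T : H →L[ℂ] H} (hT : T ∈ t.mixedSpan q p)
    {h : H} (hh : h ∈ (t.essSpace p)ᗮ) : T h = 0 := by
  refine ext_inner_left ℂ fun z => ?_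
  rw [inner_zero_right, ← ContinuousLinearMap.adjoint_inner_left,
    ← ContinuousLinearMap.star_eq_adjoint]
  exact hh _ (t.apply_mem_essSpace (t.star_mem_mixedSpan hT) z)

/-- Products $xy$ span a dense subspace of $X_r$, and $t_r(xy)k=t_p(x)(t_q(y)k)$. -/
theorem essSpace_mono {p q r : P} (h : p * q = r) : t.essSpace r ≤ t.essSpace p := by
  refine Submodule.topologicalClosure_minimal _ (Submodule.span_le.mpr ?_) (t.isClosed_essSpace p)
  rintro _ ⟨u, k, rfl⟩
  refine map_mem_of_mem_closure_span
    ((ContinuousLinearMap.apply ℂ H k) ∘L (t.toCLM r)) (t.isClosed_essSpace p) ?_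
    (S.dense_mul h u)
  rintro _ ⟨x, y, rfl⟩
  change t.toFun r (S.mul h x y) k ∈ _
  rw [← t.map_mul h]
  exact t.toFun_apply_mem_essSpace _ _

/-- Plays the role of an approximate unit of $[t_p(X_p)t_p(X_p)^*]$. Let $z$ be the component of $u$
orthogonal to the closed invariant subspace $M$ of vectors approximable from $u$. For
$T=t_p(x)t_p(x)^*$ one has $Tz\in M$, so $\|t_p(x)^*z\|^2=\langle Tz,z\rangle=0$. Thus $z$ is
orthogonal to $[t_p(X_p)H]$, which also contains it. -/
theorem mem_closure_apply {p : P} {u : H} (hu : u ∈ t.essSpace p) :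
    u ∈ ((t.mixedSpan p p).map (ContinuousLinearMap.apply ℂ H u).toLinearMap).topologicalClosure := by
  set M := ((t.mixedSpan p p).map (ContinuousLinearMap.apply ℂ H u).toLinearMap).topologicalClosure
  have hMc : IsClosed (M : Set H) := Submodule.isClosed_topologicalClosure _
  have : CompleteSpace M := hMc.completeSpace_coe
  have hsub : M ≤ t.essSpace p := by
    refine Submodule.topologicalClosure_minimal _ ?_ (t.isClosed_essSpace p)
    rintro _ ⟨T, hT, rfl⟩
    exact t.apply_mem_essSpace hT u
  have hinv : ∀ T ∈ t.mixedSpan p p, ∀ m ∈ M, T m ∈ M := by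
    intro T hT m hm
    have hc : IsClosed ((M.comap T.toLinearMap : Submodule ℂ H) : Set H) :=
      hMc.preimage T.continuous
    refine Submodule.topologicalClosure_minimal _ ?_ hc hm
    rintro _ ⟨T', hT', rfl⟩
    exact Submodule.le_topologicalClosure _ ⟨T * T', t.mul_mem_mixedSpan hT hT', rfl⟩
  obtain ⟨m, hm, z, hz, hmz⟩ := M.exists_add_mem_mem_orthogonal u
  have hz0 : ∀ x : X p, star (t.toFun p x) z = 0 := by
    intro x
    have hT := t.mem_mixedSpan x x
    set T := t.toFun p x * star (t.toFun p x) with hTdef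
    have hsT : star T = T := by rw [hTdef, star_mul, star_star]
    have h1 : T z ∈ M := by
      have : T z = T u - T m := by rw [hmz, map_add]; abel
      rw [this]
      exact M.sub_mem (Submodule.le_topologicalClosure _ ⟨T, hT, rfl⟩) (hinv T hT m hm)
    have h2 : inner ℂ (T z) z = 0 := hz _ h1
    rw [hTdef, mul_apply_eq_comp, ← ContinuousLinearMap.adjoint_inner_right,
      ← ContinuousLinearMap.star_eq_adjoint] at h2
    exact inner_self_eq_zero.mp h2
  have hze : z ∈ t.essSpace p := by
    have : z = u - m := by rw [hmz]; abel
    rw [this]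
    exact (t.essSpace p).sub_mem hu (hsub hm)
  have hzz : z = 0 := by
    have : innerSL ℂ z z ∈ (⊥ : Submodule ℂ ℂ) := by
      refine map_mem_of_mem_closure_span (innerSL ℂ z) isClosed_singleton ?_ hze
      rintro _ ⟨x, h, rfl⟩
      rw [innerSL_apply_apply, ← ContinuousLinearMap.adjoint_inner_left,
        ← ContinuousLinearMap.star_eq_adjoint, hz0 x, inner_zero_left]
      exact Submodule.zero_mem _
    exact inner_self_eq_zero.mp this
  rw [hmz, hzz, add_zero]
  exact hm

theorem onCompacts_mem_mixedSpan {p : P} (k : Compacts Aᵐᵒᵖ (X p)) :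
    t.onCompacts p k ∈ t.mixedSpan p p := by
  refine (denseRange_graphFst (B := Aᵐᵒᵖ) (t.toFun p)).induction_on
    (p := fun k => t.onCompacts p k ∈ t.mixedSpan p p) k
    ((t.isClosed_mixedSpan p p).preimage (t.onCompacts p).continuous) fun z => ?_
  have e : t.onCompacts p (graphFst (t.toFun p) z) = graphSnd (t.toFun p) z :=
    LinearMap.extendOfNorm_eq (f := graphSnd (B := Aᵐᵒᵖ) (t.toFun p))
      (e := graphFst (B := Aᵐᵒᵖ) (t.toFun p)) (denseRange_graphFst (B := Aᵐᵒᵖ) (t.toFun p))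
      ⟨1, graph_norm_le (t.toFun p) (fun b => t.toFun 1 (S.coeff (unop b)))
        (fun x y => t.map_rip x y)
        (fun b x => by rw [t.map_mul (_root_.mul_one p), S.mul_one, op_unop])⟩ z
  rw [e]
  refine Submodule.le_topologicalClosure _ ?_
  obtain ⟨z, hz⟩ := z
  change z.2 ∈ _
  have : Submodule.span ℂ {z | ∃ x y : X p, z = (rankOne Aᵐᵒᵖ x y, t.toFun p x * star (t.toFun p y))}
      ≤ (Submodule.span ℂ {T | ∃ (x : X p) (y : X p), T = t.toFun p x * star (t.toFun p y)}).comap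
        (LinearMap.snd ℂ _ _) := by
    refine Submodule.span_le.mpr ?_
    rintro _ ⟨x, y, rfl⟩
    exact Submodule.subset_span ⟨x, y, rfl⟩
  exact this hz

/-- The part of Nica covariance that concerns elements with a common right multiple, in terms of
closed spans: it makes no reference to the maps `i_p^w`. -/
def IsLCMCovariant : Prop :=
  ∀ {p q w : P}, rightIdeal p ∩ rightIdeal q = rightIdeal w →
    ∀ {T T' : H →L[ℂ] H}, T ∈ t.mixedSpan p p → T' ∈ t.mixedSpan q q → T * T' ∈ t.mixedSpan w w

theorem exists_mul_eq_of_inter_eq {p q w : P}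
    (h : rightIdeal p ∩ rightIdeal q = rightIdeal w) : (∃ p', p * p' = w) ∧ ∃ q', q * q' = w := by
  have hw : w ∈ rightIdeal p ∩ rightIdeal q := h ▸ ⟨1, _root_.mul_one w⟩
  exact hw

/-- By continuity it is enough to multiply two rank one terms. Nica covariance turns the product
into the image under $t_w$ of an element of $\mathcal K(X_w)$, which compact alignment provides. -/
theorem IsNicaCovariant.isLCMCovariant {t : S.ToeplitzRep H} {hS : S.IsCompactlyAligned}
    (hN : t.IsNicaCovariant hS) : t.IsLCMCovariant := by
  intro p q w h T T' hT hT'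
  obtain ⟨⟨p', hp⟩, q', hq⟩ := exists_mul_eq_of_inter_eq h
  refine mul_mem_of_mem_closure_span (t.isClosed_mixedSpan w w) ?_ hT hT'
  rintro _ ⟨x, y, rfl⟩ _ ⟨x', y', rfl⟩
  rw [← t.onCompacts_rankOne, ← t.onCompacts_rankOne, hN.1 h hp hq]
  exact t.onCompacts_mem_mixedSpan _

variable {t}

namespace IsLCMCovariant

/-- Approximate $u$ by $Tu$, with $T$ from $p$, and then $Tu$ by $TT'u$, with $T'$ from $q$; the
product $TT'$ has range in $[t_w(X_w)H]$. -/
theorem inf_essSpace_le (hL : t.IsLCMCovariant) {p q w : P}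
    (h : rightIdeal p ∩ rightIdeal q = rightIdeal w) {u : H} (hp : u ∈ t.essSpace p)
    (hq : u ∈ t.essSpace q) : u ∈ t.essSpace w := by
  refine Submodule.topologicalClosure_minimal _ ?_ (t.isClosed_essSpace w) (t.mem_closure_apply hp)
  rintro _ ⟨T, hT, rfl⟩
  have hc : IsClosed (((t.essSpace w).comap T.toLinearMap : Submodule ℂ H) : Set H) :=
    (t.isClosed_essSpace w).preimage T.continuous
  refine Submodule.topologicalClosure_minimal _ ?_ hc (t.mem_closure_apply hq)
  rintro _ ⟨T', hT', rfl⟩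
  exact t.apply_mem_essSpace (hL h hT hT') u

/-- Replacing $u$ by an approximant $T'u$ puts $TT'u$ in $[t_w(X_w)H]\subseteq[t_q(X_q)H]$. Applied
to $T^*$ as well, this says that $[t_q(X_q)H]$ reduces $T$. -/
theorem apply_mem_essSpace (hL : t.IsLCMCovariant) {p q w : P}
    (h : rightIdeal p ∩ rightIdeal q = rightIdeal w) {T : H →L[ℂ] H} (hT : T ∈ t.mixedSpan p p)
    {u : H} (hu : u ∈ t.essSpace q) : T u ∈ t.essSpace q := by
  obtain ⟨-, q', hq⟩ := exists_mul_eq_of_inter_eq h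
  have hc : IsClosed (((t.essSpace q).comap T.toLinearMap : Submodule ℂ H) : Set H) :=
    (t.isClosed_essSpace q).preimage T.continuous
  refine Submodule.topologicalClosure_minimal _ ?_ hc (t.mem_closure_apply hu)
  rintro _ ⟨T', hT', rfl⟩
  exact t.essSpace_mono hq (t.apply_mem_essSpace (hL h hT hT') u)

theorem apply_mem_orthogonal (hL : t.IsLCMCovariant) {p q w : P}
    (h : rightIdeal p ∩ rightIdeal q = rightIdeal w) {T : H →L[ℂ] H} (hT : T ∈ t.mixedSpan p p)
    {u : H} (hu : u ∈ (t.essSpace q)ᗮ) : T u ∈ (t.essSpace q)ᗮ := by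
  intro v hv
  rw [← ContinuousLinearMap.adjoint_inner_left, ← ContinuousLinearMap.star_eq_adjoint]
  exact hu _ (hL.apply_mem_essSpace h (t.star_mem_mixedSpan hT) hv)

/-- The Wick ordering relation. Approximating $y$ and $x$ by $y\langle y',y\rangle$ and $x\langle
x',x\rangle$ produces a factor $t_q(y')t_q(y)^*\,t_p(x)t_p(x')^*$ in the middle. Covariance puts it
in $[t_w(X_w)t_w(X_w)^*]$, and the outer factors $t_q(y)^*$ and $t_p(x)$ then lower $w$ to $q'$ on
the left and to $p'$ on the right. -/
theorem star_mul_mem_mixedSpan (hL : t.IsLCMCovariant) {p q w p' q' : P}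
    (h : rightIdeal q ∩ rightIdeal p = rightIdeal w) (hp : p * p' = w) (hq : q * q' = w)
    (y : X q) (x : X p) : star (t.toFun q y) * t.toFun p x ∈ t.mixedSpan q' p' := by
  have hcl := t.isClosed_mixedSpan q' p'
  have hmid : ∀ W ∈ t.mixedSpan w w, star (t.toFun q y) * W * t.toFun p x ∈ t.mixedSpan q' p' := by
    intro W hW
    refine map_mem_of_mem_closure_span (((ContinuousLinearMap.mul ℂ (H →L[ℂ] H)).flip
      (t.toFun p x)) ∘L (ContinuousLinearMap.mul ℂ (H →L[ℂ] H) (star (t.toFun q y)))) hcl ?_ hW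
    rintro _ ⟨u, v, rfl⟩
    have e : star (t.toFun q y) * (t.toFun w u * star (t.toFun w v)) * t.toFun p x =
        t.toFun q' (S.annihilation hq y u) * star (t.toFun p' (S.annihilation hp x v)) := by
      rw [← t.star_toFun_mul_toFun hq, ← t.star_toFun_mul_toFun hp, star_mul, star_star]
      simp only [_root_.mul_assoc]
    change star (t.toFun q y) * (t.toFun w u * star (t.toFun w v)) * t.toFun p x ∈ _
    rw [e]
    exact t.mem_mixedSpan _ _
  have h1 : IsClosed {z : X q | star (t.toFun q z) * t.toFun p x ∈ t.mixedSpan q' p'} :=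
    hcl.preimage (((continuous_star.comp (t.toCLM q).continuous)).mul continuous_const)
  refine closure_minimal ?_ h1 (mem_closure_inner_smul (B := Aᵐᵒᵖ) y)
  rintro _ ⟨y', rfl⟩
  have h2 : IsClosed {z : X p | star (t.toFun q (inner Aᵐᵒᵖ y' y • y)) * t.toFun p z ∈
      t.mixedSpan q' p'} := hcl.preimage (continuous_const.mul (t.toCLM p).continuous)
  refine closure_minimal ?_ h2 (mem_closure_inner_smul (B := Aᵐᵒᵖ) x)
  rintro _ ⟨x', rfl⟩
  have key : ∀ {r : P} (a b : X r),
      t.toFun r (inner Aᵐᵒᵖ b a • a) = t.toFun r a * (star (t.toFun r b) * t.toFun r a) := by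
    intro r a b
    rw [t.star_mul_self_eq, t.mul_coeffHom, op_unop]
  have e : star (t.toFun q (inner Aᵐᵒᵖ y' y • y)) * t.toFun p (inner Aᵐᵒᵖ x' x • x) =
      star (t.toFun q y) * ((t.toFun q y' * star (t.toFun q y)) *
        (t.toFun p x * star (t.toFun p x'))) * t.toFun p x := by
    rw [key, key, star_mul, star_mul, star_star]
    simp only [_root_.mul_assoc]
  rw [Set.mem_ofPred_eq, e]
  exact hmid _ (hL h (t.mem_mixedSpan _ _) (t.mem_mixedSpan _ _))

end IsLCMCovariant

end ProductSystem.ToeplitzRep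

end RepFacts

/-! ### The estimate for diagonal sums, by cutting $H$ with commuting projections. -/

section DiagonalEstimate

variable {A : Type*} [NonUnitalCStarAlgebra A] [PartialOrder A] [StarOrderedRing A]
variable {P : Type*} [Monoid P] {X : P → Type*}
  [∀ p, NormedAddCommGroup (X p)] [∀ p, NormedSpace ℂ (X p)] [∀ p, SMul Aᵐᵒᵖ (X p)]
  [∀ p, CStarModule Aᵐᵒᵖ (X p)] [∀ p, CompleteSpace (X p)]
variable {S : ProductSystem A P X}

open scoped RightActions

namespace ProductSystem.ToeplitzRep

variable {H : Type*} [NormedAddCommGroup H] [InnerProductSpace ℂ H] [CompleteSpace H]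
variable {t : S.ToeplitzRep H}

namespace IsLCMCovariant

theorem starProjection_apply_comm (hL : t.IsLCMCovariant) {p q w : P}
    (h : rightIdeal p ∩ rightIdeal q = rightIdeal w) {T : H →L[ℂ] H} (hT : T ∈ t.mixedSpan p p)
    (u : H) : (t.essSpace q).starProjection (T u) = T ((t.essSpace q).starProjection u) := by
  refine (Submodule.eq_starProjection_of_mem_orthogonal
    (hL.apply_mem_essSpace h hT (Submodule.starProjection_apply_mem _ u)) ?_)
  rw [← map_sub]
  exact hL.apply_mem_orthogonal h hT (Submodule.sub_starProjection_mem_orthogonal u)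

/-- With $Q$ the projection for $q$, approximate $u$ by $Tu$ with $T$ from $p$: then $QTu=TQu$ lies
in the range of $T$. Hence the projections for $p$ and $q$ commute. -/
theorem starProjection_mem_essSpace (hL : t.IsLCMCovariant) {p q w : P}
    (h : rightIdeal p ∩ rightIdeal q = rightIdeal w) {u : H} (hu : u ∈ t.essSpace p) :
    (t.essSpace q).starProjection u ∈ t.essSpace p := by
  have hc : IsClosed (((t.essSpace p).comap (t.essSpace q).starProjection.toLinearMap :
      Submodule ℂ H) : Set H) :=
    (t.isClosed_essSpace p).preimage (t.essSpace q).starProjection.continuous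
  refine Submodule.topologicalClosure_minimal _ ?_ hc (t.mem_closure_apply hu)
  rintro _ ⟨T, hT, rfl⟩
  change (t.essSpace q).starProjection (T u) ∈ t.essSpace p
  rw [hL.starProjection_apply_comm h hT]
  exact t.apply_mem_essSpace hT _

theorem starProjection_mem_orthogonal (hL : t.IsLCMCovariant) {p q w : P}
    (h : rightIdeal p ∩ rightIdeal q = rightIdeal w) {u : H} (hu : u ∈ (t.essSpace p)ᗮ) :
    (t.essSpace q).starProjection u ∈ (t.essSpace p)ᗮ := by
  intro v hv
  rw [← Submodule.inner_starProjection_left_eq_right]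
  exact hu _ (hL.starProjection_mem_essSpace h hv)

/-- Adjoins the elements of $D$ one at a time. The common right multiple $r$ keeps every
intersection of ideals nonempty, so the LCM condition applies at each stage, and `inf_essSpace_le`
carries $u$ along. -/
theorem exists_lcm (hP : IsRightLCM P) (hL : t.IsLCMCovariant) {r : P} {u : H} {D : Finset P}
    (hD : D.Nonempty) (hr : ∀ p ∈ D, r ∈ rightIdeal p) (hu : ∀ p ∈ D, u ∈ t.essSpace p) :
    ∃ w, r ∈ rightIdeal w ∧ u ∈ t.essSpace w ∧ ∀ p ∈ D, w ∈ rightIdeal p := by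
  induction hD using Finset.Nonempty.cons_induction with
  | singleton p =>
    exact ⟨p, hr p (by simp), hu p (by simp), fun q hq => by
      rw [Finset.mem_singleton.mp hq]; exact ⟨1, _root_.mul_one p⟩⟩
  | cons p D hp hD ih =>
    obtain ⟨v, hv, huv, hDv⟩ := ih (fun q hq => hr q (Finset.mem_cons_of_mem hq))
      (fun q hq => hu q (Finset.mem_cons_of_mem hq))
    have hrp := hr p (Finset.mem_cons_self p D)
    obtain ⟨w, hw⟩ := hP p v ⟨r, hrp, hv⟩
    obtain ⟨hpw, v', hvw⟩ := exists_mul_eq_of_inter_eq hw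
    refine ⟨w, hw ▸ ⟨hrp, hv⟩,
      hL.inf_essSpace_le hw (hu p (Finset.mem_cons_self p D)) huv, fun q hq => ?_⟩
    rcases Finset.mem_cons.mp hq with rfl | hq
    · exact hpw
    · obtain ⟨z, rfl⟩ := hDv q hq
      exact ⟨z * v', by rw [← hvw]; exact (_root_.mul_assoc _ _ _).symm⟩

open scoped Classical in
/-- The norm of a finite sum of operators `T_p ∈ [t_p(X_p) t_p(X_p)*]` over the `p` dividing `r`
is controlled by the corresponding sums on the subspaces `[t_s(X_s) H]`. -/
theorem norm_sum_apply_le (hP : IsRightLCM P) (hL : t.IsLCMCovariant) {T : P → (H →L[ℂ] H)}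
    (hT : ∀ p, T p ∈ t.mixedSpan p p) (F : Finset P) {M : ℝ} (hM0 : 0 ≤ M)
    (hM : ∀ s, ∀ u ∈ t.essSpace s, ‖∑ p ∈ F with s ∈ rightIdeal p, T p u‖ ≤ M * ‖u‖)
    (r : P) (u : H) : ‖∑ p ∈ F with r ∈ rightIdeal p, T p u‖ ≤ M * ‖u‖ := by
  set F' := F.filter fun p => r ∈ rightIdeal p with hF'
  have hlcm : ∀ p ∈ F', ∀ q ∈ F', ∃ w, rightIdeal p ∩ rightIdeal q = rightIdeal w :=
    fun p hp q hq => hP p q ⟨r, (Finset.mem_filter.mp hp).2, (Finset.mem_filter.mp hq).2⟩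
  -- Here $L$ holds the indices whose projections have not yet been used to split $u$; those in $D$
  -- have $u$ in their range, and the remaining ones are orthogonal to it.
  have key : ∀ L : Finset P, L ⊆ F' → ∀ D ⊆ F', ∀ u : H, (∀ p ∈ D, u ∈ t.essSpace p) →
      (∀ p ∈ F', p ∉ L → p ∉ D → u ∈ (t.essSpace p)ᗮ) → ‖∑ p ∈ F', T p u‖ ≤ M * ‖u‖ := by
    intro L
    induction L using Finset.induction_on with
    | empty =>
      intro _ D hD u hu hu'
      have e : ∑ p ∈ F', T p u = ∑ p ∈ D, T p u := by
        refine (Finset.sum_subset hD fun p hp hpD => ?_).symm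
        exact t.apply_eq_zero_of_mem_orthogonal (hT p) (hu' p hp (by simp) hpD)
      rcases D.eq_empty_or_nonempty with rfl | hne
      · rw [e, Finset.sum_empty, norm_zero]; positivity
      obtain ⟨w, hrw, huw, hw⟩ := exists_lcm hP hL hne
        (fun p hp => (Finset.mem_filter.mp (hD hp)).2) hu
      refine le_trans (le_of_eq ?_) (hM w u huw)
      rw [e]
      congr 1
      -- Every $p\in F$ dividing $w$ also divides $r$, hence lies in $F'$. If it is not in $D$, then
      -- $u$ is orthogonal to its range and $T_pu=0$, so the sum over $D$ is the full sum attached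
      -- to $w$.
      refine Finset.sum_subset (fun p hp => ?_) fun p hp hpD => ?_
      · exact Finset.mem_filter.mpr ⟨(Finset.mem_filter.mp (hD hp)).1, hw p hp⟩
      · obtain ⟨hpF, z, rfl⟩ := Finset.mem_filter.mp hp
        obtain ⟨z', hz'⟩ := hrw
        refine t.apply_eq_zero_of_mem_orthogonal (hT p) (hu' p ?_ (by simp) hpD)
        exact Finset.mem_filter.mpr ⟨hpF, z * z', by
          rw [← hz']; exact (_root_.mul_assoc _ _ _).symm⟩
    | insert q L hq ih =>
      intro hL' D hD u hu hu'
      obtain ⟨hqF, hLF⟩ := Finset.insert_subset_iff.mp hL'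
      -- Split $u$ as $Qu+(u-Qu)$. Both parts keep their position relative to the ranges already
      -- treated, because the projections commute, and the induction hypothesis applies to $Qu$ with
      -- $q$ added to $D$ and to $u-Qu$ with $D$ unchanged.
      set Q := (t.essSpace q).starProjection
      have hQ : Q u ∈ t.essSpace q := Submodule.starProjection_apply_mem _ u
      have hQ' : u - Q u ∈ (t.essSpace q)ᗮ := Submodule.sub_starProjection_mem_orthogonal u
      have h1 : ‖∑ p ∈ F', T p (Q u)‖ ≤ M * ‖Q u‖ := by
        refine ih hLF (insert q D) (Finset.insert_subset hqF hD) (Q u) (fun p hp => ?_)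
          fun p hp hpL hpD => ?_
        · rcases Finset.mem_insert.mp hp with rfl | hp
          · exact hQ
          · obtain ⟨w, hw⟩ := hlcm p (hD hp) q hqF
            exact hL.starProjection_mem_essSpace hw (hu p hp)
        · obtain ⟨w, hw⟩ := hlcm p hp q hqF
          simp only [Finset.mem_insert, not_or] at hpD
          exact hL.starProjection_mem_orthogonal hw
            (hu' p hp (by simp [hpL, hpD.1]) hpD.2)
      have h2 : ‖∑ p ∈ F', T p (u - Q u)‖ ≤ M * ‖u - Q u‖ := by
        refine ih hLF D hD (u - Q u) (fun p hp => ?_) fun p hp hpL hpD => ?_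
        · obtain ⟨w, hw⟩ := hlcm p (hD hp) q hqF
          exact Submodule.sub_mem _ (hu p hp) (hL.starProjection_mem_essSpace hw (hu p hp))
        · by_cases hpq : p = q
          · exact hpq ▸ hQ'
          · obtain ⟨w, hw⟩ := hlcm p hp q hqF
            have h3 := hu' p hp (by simp [hpL, hpq]) hpD
            exact Submodule.sub_mem _ h3 (hL.starProjection_mem_orthogonal hw h3)
      have m1 : ∑ p ∈ F', T p (Q u) ∈ t.essSpace q := by
        refine Submodule.sum_mem _ fun p hp => ?_
        obtain ⟨w, hw⟩ := hlcm p hp q hqF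
        exact hL.apply_mem_essSpace hw (hT p) hQ
      have m2 : ∑ p ∈ F', T p (u - Q u) ∈ (t.essSpace q)ᗮ := by
        refine Submodule.sum_mem _ fun p hp => ?_
        obtain ⟨w, hw⟩ := hlcm p hp q hqF
        exact hL.apply_mem_orthogonal hw (hT p) hQ'
      have e : ∑ p ∈ F', T p u = ∑ p ∈ F', T p (Q u) + ∑ p ∈ F', T p (u - Q u) := by
        rw [← Finset.sum_add_distrib]
        exact Finset.sum_congr rfl fun p _ => by rw [← map_add, add_sub_cancel]
      -- Pythagoras for the images and for the vectors: the two bounds combine with the same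
      -- constant $M$.
      have n1 := norm_add_sq_eq_norm_sq_add_norm_sq_of_inner_eq_zero
        (𝕜 := ℂ) _ _ (m2 _ m1)
      have n2 := norm_add_sq_eq_norm_sq_add_norm_sq_of_inner_eq_zero
        (𝕜 := ℂ) _ _ (hQ' _ hQ)
      rw [← e] at n1
      rw [add_sub_cancel] at n2
      refine le_of_sq_le_sq ?_ (by positivity)
      rw [mul_pow]
      have q1 := mul_self_le_mul_self (norm_nonneg _) h1
      have q2 := mul_self_le_mul_self (norm_nonneg _) h2
      nlinarith
  exact key F' subset_rfl ∅ (Finset.empty_subset _) u (by simp) fun p hp hp' => absurd hp hp'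

end IsLCMCovariant

end ProductSystem.ToeplitzRep

end DiagonalEstimate

/-! ### The closed span of the $t_p(x)t_q(y)^*\otimes V_pV_q^*$ and the diagonals of its elements.
-/

section FellSpan

variable {A : Type*} [NonUnitalCStarAlgebra A] [PartialOrder A] [StarOrderedRing A]
variable {P : Type*} [Monoid P] [IsCancelMul P] {X : P → Type*}
  [∀ p, NormedAddCommGroup (X p)] [∀ p, NormedSpace ℂ (X p)] [∀ p, SMul Aᵐᵒᵖ (X p)]
  [∀ p, CStarModule Aᵐᵒᵖ (X p)] [∀ p, CompleteSpace (X p)]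
variable {S : ProductSystem A P X}

open scoped RightActions

namespace ProductSystem.ToeplitzRep

variable {H : Type*} [NormedAddCommGroup H] [InnerProductSpace ℂ H] [CompleteSpace H]
variable (t : S.ToeplitzRep H)

/-- The operator `t_p(x) ⊗ V_p`. -/
def fell {p : P} (x : X p) : TensorSpace H (ell2 P) →L[ℂ] TensorSpace H (ell2 P) :=
  tensorOp (t.toFun p x) (shift p)

/-- The closed linear span of the operators `t_p(x) t_q(y)* ⊗ V_p V_q*`. -/
def fellSpan : Submodule ℂ (TensorSpace H (ell2 P) →L[ℂ] TensorSpace H (ell2 P)) :=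
  (Submodule.span ℂ {a | ∃ (p q : P) (x : X p) (y : X q),
    a = tensorOp (t.toFun p x * star (t.toFun q y)) (shift p * star (shift q))}).topologicalClosure

theorem isClosed_fellSpan : IsClosed (t.fellSpan : Set (TensorSpace H (ell2 P) →L[ℂ] TensorSpace H (ell2 P))) :=
  Submodule.isClosed_topologicalClosure _

theorem mem_fellSpan {p q : P} (x : X p) (y : X q) :
    tensorOp (t.toFun p x * star (t.toFun q y)) (shift p * star (shift q)) ∈ t.fellSpan :=
  Submodule.le_topologicalClosure _ (Submodule.subset_span ⟨p, q, x, y, rfl⟩)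

theorem tensorOp_mem_fellSpan {p q : P} {T : H →L[ℂ] H} (hT : T ∈ t.mixedSpan p q) :
    tensorOp T (shift p * star (shift q)) ∈ t.fellSpan := by
  refine map_mem_of_mem_closure_span (tensorOpLeft (shift p * star (shift q)))
    t.isClosed_fellSpan ?_ hT
  rintro _ ⟨x, y, rfl⟩
  exact t.mem_fellSpan x y

/-- Take $q=e$: $V_e=1$, and $x$ is a limit of elements $xa$, for which $t_p(xa)=t_p(x)t_e(a^*)^*$.
-/
theorem fell_mem_fellSpan {p : P} (x : X p) : t.fell x ∈ t.fellSpan := by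
  have e1 : shift p = shift p * star (shift (1 : P)) := by
    have : shift (1 : P) = 1 := ext_basisVec fun r => by rw [shift_basisVec, _root_.one_mul]; rfl
    rw [this, star_one, _root_.mul_one]
  have hx : t.toFun p x ∈ t.mixedSpan p 1 := by
    have hc : IsClosed {z : X p | t.toFun p z ∈ t.mixedSpan p 1} :=
      (t.isClosed_mixedSpan p 1).preimage (t.toCLM p).continuous
    refine closure_minimal ?_ hc (mem_closure_inner_smul (B := Aᵐᵒᵖ) x)
    rintro _ ⟨y, rfl⟩
    have e : t.toFun p (inner Aᵐᵒᵖ y x • x) =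
        t.toFun p x * star (t.toFun 1 (S.coeff (star (rip A y x)))) := by
      rw [← t.map_star, star_star, ← t.coeffHom_apply, t.mul_coeffHom, op_unop]
    change t.toFun p (inner Aᵐᵒᵖ y x • x) ∈ t.mixedSpan p 1
    rw [e]
    exact t.mem_mixedSpan _ _
  rw [fell, e1]
  exact t.tensorOp_mem_fellSpan hx

theorem star_mem_fellSpan {a : TensorSpace H (ell2 P) →L[ℂ] TensorSpace H (ell2 P)}
    (ha : a ∈ t.fellSpan) : star a ∈ t.fellSpan := by
  refine map_mem_of_mem_closure_span
    (starL ℂ : (TensorSpace H (ell2 P) →L[ℂ] TensorSpace H (ell2 P)) ≃L⋆[ℂ]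
      _).toContinuousLinearMap t.isClosed_fellSpan ?_ ha
  rintro _ ⟨p, q, x, y, rfl⟩
  change star (tensorOp _ _) ∈ t.fellSpan
  rw [star_tensorOp, star_mul, star_star, star_mul, star_star]
  exact t.mem_fellSpan y x

theorem fell_mul_mem_fellSpan {s : P} (z : X s)
    {a : TensorSpace H (ell2 P) →L[ℂ] TensorSpace H (ell2 P)}
    (ha : a ∈ t.fellSpan) : t.fell z * a ∈ t.fellSpan := by
  refine map_mem_of_mem_closure_span
    (ContinuousLinearMap.mul ℂ (TensorSpace H (ell2 P) →L[ℂ] TensorSpace H (ell2 P))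
      (t.fell z)) t.isClosed_fellSpan ?_ ha
  rintro _ ⟨p, q, x, y, rfl⟩
  change t.fell z * _ ∈ t.fellSpan
  rw [fell, tensorOp_mul, ← _root_.mul_assoc, ← _root_.mul_assoc, t.map_mul rfl, shift_mul]
  exact t.mem_fellSpan _ _

variable {t}

/-- If $sP\cap pP=\emptyset$, the shift factor $V_s^*V_p$ is already zero. If $sP\cap pP=wP$ with
$w=ss'=pp'$, the relations for $t$ and for the shifts both reorder to type $(s',p')$, so the two
tensor factors stay matched. -/
theorem IsLCMCovariant.star_fell_mul_mem_fellSpan (hP : IsRightLCM P) (hL : t.IsLCMCovariant)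
    {s : P} (z : X s) {a : TensorSpace H (ell2 P) →L[ℂ] TensorSpace H (ell2 P)}
    (ha : a ∈ t.fellSpan) : star (t.fell z) * a ∈ t.fellSpan := by
  refine map_mem_of_mem_closure_span
    (ContinuousLinearMap.mul ℂ (TensorSpace H (ell2 P) →L[ℂ] TensorSpace H (ell2 P))
      (star (t.fell z))) t.isClosed_fellSpan ?_ ha
  rintro _ ⟨p, q, x, y, rfl⟩
  change star (t.fell z) * _ ∈ t.fellSpan
  rw [fell, star_tensorOp, tensorOp_mul, ← _root_.mul_assoc, ← _root_.mul_assoc]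
  rcases (rightIdeal s ∩ rightIdeal p).eq_empty_or_nonempty with h | h
  · rw [star_shift_mul_shift_of_disjoint h, zero_mul]
    have e : tensorOp (star (t.toFun s z) * t.toFun p x * star (t.toFun q y))
        (0 : ell2 P →L[ℂ] ell2 P) = 0 := ext_slice fun r u => by
      rw [tensorOp_slice_of_eq_zero (by simp)]; simp
    rw [e]
    exact Submodule.zero_mem _
  · obtain ⟨w, hw⟩ := hP s p h
    obtain ⟨⟨s', hs⟩, p', hp⟩ := exists_mul_eq_of_inter_eq hw
    rw [star_shift_mul_shift hw hp hs, _root_.mul_assoc (shift s'), ← star_mul, shift_mul]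
    refine t.tensorOp_mem_fellSpan (p := s') (q := q * p') ?_
    refine mul_mem_of_mem_closure_span (t.isClosed_mixedSpan s' (q * p'))
      (s' := {star (t.toFun q y)}) ?_ (hL.star_mul_mem_mixedSpan hw hp hs z x)
      (Submodule.le_topologicalClosure _ (Submodule.subset_span rfl))
    rintro _ ⟨u, v, rfl⟩ _ rfl
    rw [_root_.mul_assoc, ← star_mul, t.map_mul rfl]
    exact t.mem_mixedSpan _ _

theorem IsLCMCovariant.adjoin_le_fellSpan (hP : IsRightLCM P) (hL : t.IsLCMCovariant)
    {a : TensorSpace H (ell2 P) →L[ℂ] TensorSpace H (ell2 P)}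
    (ha : a ∈ NonUnitalStarAlgebra.adjoin ℂ
      {T | ∃ (p : P) (x : X p), T = t.fell x}) : a ∈ t.fellSpan := by
  -- Membership alone is not inductive. Carrying along that both $a$ and $a^*$ are left multipliers
  -- of the span handles products and adjoints without multiplying two general spanning elements.
  suffices h : (a ∈ t.fellSpan ∧ ∀ b ∈ t.fellSpan, a * b ∈ t.fellSpan) ∧
      ∀ b ∈ t.fellSpan, star a * b ∈ t.fellSpan from h.1.1
  induction ha using NonUnitalStarAlgebra.adjoin_induction with
  | mem a h =>
    obtain ⟨p, x, rfl⟩ := h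
    exact ⟨⟨t.fell_mem_fellSpan x, fun b hb => t.fell_mul_mem_fellSpan x hb⟩,
      fun b hb => hL.star_fell_mul_mem_fellSpan hP x hb⟩
  | add a b _ _ ha hb =>
    refine ⟨⟨add_mem ha.1.1 hb.1.1, fun c hc => ?_⟩, fun c hc => ?_⟩
    · rw [add_mul]; exact add_mem (ha.1.2 c hc) (hb.1.2 c hc)
    · rw [star_add, add_mul]; exact add_mem (ha.2 c hc) (hb.2 c hc)
  | zero => simp
  | mul a b _ _ ha hb =>
    refine ⟨⟨ha.1.2 b hb.1.1, fun c hc => ?_⟩, fun c hc => ?_⟩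
    · rw [_root_.mul_assoc]; exact ha.1.2 _ (hb.1.2 c hc)
    · rw [star_mul, _root_.mul_assoc]; exact hb.2 _ (ha.2 c hc)
  | smul k a _ ha =>
    refine ⟨⟨Submodule.smul_mem _ k ha.1.1, fun c hc => ?_⟩, fun c hc => ?_⟩
    · rw [smul_mul_assoc]; exact Submodule.smul_mem _ k (ha.1.2 c hc)
    · rw [star_smul, smul_mul_assoc]; exact Submodule.smul_mem _ _ (ha.2 c hc)
  | star a _ ha =>
    exact ⟨⟨t.star_mem_fellSpan ha.1.1, ha.2⟩, by rw [star_star]; exact ha.1.2⟩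

-- The operator $V_pV_q^*$ sends $e_{qz}$ to $e_{pz}$ and kills the other basis vectors. If $p\ne
-- q$, right cancellation gives $pz\ne qz$, so nothing reaches the diagonal; if $p=q$, it is the
-- projection onto the span of the $e_r$ with $r\in pP$.
open scoped Classical in
theorem exists_diagEntry_eq {a : TensorSpace H (ell2 P) →L[ℂ] TensorSpace H (ell2 P)}
    (ha : a ∈ Submodule.span ℂ {a | ∃ (p q : P) (x : X p) (y : X q),
      a = tensorOp (t.toFun p x * star (t.toFun q y)) (shift p * star (shift q))}) :
    ∃ T : P →₀ (H →L[ℂ] H), (∀ p, T p ∈ t.mixedSpan p p) ∧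
      ∀ r, diagEntry r a = T.sum fun p k => if r ∈ rightIdeal p then k else 0 := by
  induction ha using Submodule.span_induction with
  | mem a h =>
    obtain ⟨p, q, x, y, rfl⟩ := h
    by_cases hpq : p = q
    · subst hpq
      refine ⟨Finsupp.single p (t.toFun p x * star (t.toFun p y)), fun s => ?_, fun r => ?_⟩
      · rw [Finsupp.single_apply]
        split_ifs with h
        · exact h ▸ t.mem_mixedSpan x y
        · exact Submodule.zero_mem _
      · rw [Finsupp.sum_single_index (by simp)]
        split_ifs with h
        · obtain ⟨z, rfl⟩ := h
          refine diagEntry_tensorOp ?_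
          rw [mul_apply_eq_comp, star_shift_basisVec_mul, shift_basisVec]
        · refine diagEntry_tensorOp_eq_zero (Or.inl ?_)
          rw [mul_apply_eq_comp, star_shift_basisVec_of_notMem h, map_zero]
    · refine ⟨0, fun s => Submodule.zero_mem _, fun r => ?_⟩
      rw [Finsupp.sum_zero_index]
      refine diagEntry_tensorOp_eq_zero ?_
      rw [mul_apply_eq_comp]
      by_cases h : r ∈ rightIdeal q
      · obtain ⟨z, rfl⟩ := h
        refine Or.inr ⟨p * z, fun h => hpq (mul_right_cancel h), ?_⟩
        rw [star_shift_basisVec_mul, shift_basisVec]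
      · left
        rw [star_shift_basisVec_of_notMem h, map_zero]
  | zero => exact ⟨0, fun s => Submodule.zero_mem _, fun r => by simp [diagEntry]⟩
  | add a b _ _ ha hb =>
    obtain ⟨T, hT, hTa⟩ := ha
    obtain ⟨T', hT', hTb⟩ := hb
    refine ⟨T + T', fun p => add_mem (hT p) (hT' p), fun r => ?_⟩
    rw [diagEntry_add, hTa, hTb, Finsupp.sum_add_index' (by simp)]
    intro p k l
    split_ifs <;> simp
  | smul c a _ ha =>
    obtain ⟨T, hT, hTa⟩ := ha
    refine ⟨c • T, fun p => Submodule.smul_mem _ c (hT p), fun r => ?_⟩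
    rw [diagEntry_smul, hTa, Finsupp.sum_smul_index' (by simp), Finsupp.smul_sum]
    refine Finsupp.sum_congr fun p _ => ?_
    split_ifs <;> simp

/-- Approximate $c$ within $\delta$ by a finite sum $a$. On $[t_s(X_s)H]$ the $s$-th entry of $c$ is
zero, so that of $a$ has norm at most $\delta$ there; `norm_sum_apply_le` extends this bound to all
of $H$, and the $r$-th entry of $c$ is within $\delta$ of that of $a$. -/
theorem IsLCMCovariant.diagEntry_eq_zero (hP : IsRightLCM P) (hL : t.IsLCMCovariant)
    {c : TensorSpace H (ell2 P) →L[ℂ] TensorSpace H (ell2 P)} (hc : c ∈ t.fellSpan)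
    (h0 : ∀ s, ∀ u ∈ t.essSpace s, c (slice s u) = 0) (r : P) : diagEntry r c = 0 := by
  classical
  ext u
  rw [zero_apply, ← norm_le_zero_iff]
  refine le_of_forall_pos_le_add fun ε hε => ?_
  rw [zero_add]
  -- Two errors of size $\delta\|u\|$ have to fit in $\varepsilon$; the added $1$ covers $u=0$.
  set δ := ε / (2 * (‖u‖ + 1)) with hδ
  have hu1 : 0 < ‖u‖ + 1 := by positivity
  have hδ0 : 0 < δ := by positivity
  obtain ⟨a, ha, hd⟩ := Metric.mem_closure_iff.mp hc δ hδ0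
  rw [dist_eq_norm] at hd
  obtain ⟨T, hT, hTa⟩ := exists_diagEntry_eq ha
  have hsum : ∀ s v, diagEntry s a v = ∑ p ∈ T.support with s ∈ rightIdeal p, T p v := by
    intro s v
    rw [hTa, Finsupp.sum, _root_.sum_apply, Finset.sum_filter]
    exact Finset.sum_congr rfl fun p _ => by split_ifs <;> simp
  have hdiff : ∀ s (v : H), ‖diagEntry s (c - a) v‖ ≤ δ * ‖v‖ := fun s v =>
    (norm_diagEntry_apply_le s _ v).trans <| by
      have := (c - a).le_of_opNorm_le hd.le (slice s v)
      rwa [(slice s).norm_map] at this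
  have hle := hL.norm_sum_apply_le hP hT T.support hδ0.le (fun s v hv => by
    rw [← hsum]
    have h1 := hdiff s v
    have h2 : diagEntry s c v = 0 := by
      rw [← norm_le_zero_iff]
      refine (norm_diagEntry_apply_le s c v).trans_eq ?_
      rw [h0 s v hv, norm_zero]
    rwa [diagEntry_sub, _root_.sub_apply, h2, zero_sub, norm_neg] at h1) r u
  rw [← hsum] at hle
  have h3 : diagEntry r c u = diagEntry r (c - a) u + diagEntry r a u := by
    rw [diagEntry_sub]; simp
  calc ‖diagEntry r c u‖ ≤ δ * ‖u‖ + δ * ‖u‖ := by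
        rw [h3]; exact (norm_add_le _ _).trans (add_le_add (hdiff r u) hle)
    _ ≤ 2 * δ * (‖u‖ + 1) := by nlinarith
    _ = ε := by rw [hδ]; field_simp

end ProductSystem.ToeplitzRep

end FellSpan

/-! ### Homomorphisms of C⋆-algebras from their graphs. -/

section Graphs

variable {C D : Type*} [NonUnitalCStarAlgebra C] [NonUnitalCStarAlgebra D]

/-- A closed star subalgebra of `C × D` that meets both factors trivially is the graph of an
isomorphism of C⋆-subalgebras of `C` and `D`. -/
theorem exists_starHom_of_graph (G : NonUnitalStarSubalgebra ℂ (C × D))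
    (hG : IsClosed (G : Set (C × D))) (h1 : ∀ z ∈ G, z.1 = 0 → z.2 = 0)
    (h2 : ∀ z ∈ G, z.2 = 0 → z.1 = 0) (s : Set C) (hs : ∀ a ∈ s, ∃ b, (a, b) ∈ G)
    (D₀ : NonUnitalStarSubalgebra ℂ D) (hD : ∀ z ∈ G, z.2 ∈ D₀) :
    ∃ φ : (NonUnitalStarAlgebra.adjoin ℂ s).topologicalClosure →⋆ₙₐ[ℂ] D₀,
      Function.Injective φ ∧ ∀ (a : C) (b : D) (_ : (a, b) ∈ G)
        (ha : a ∈ (NonUnitalStarAlgebra.adjoin ℂ s).topologicalClosure), (φ ⟨a, ha⟩ : D) = b := by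
  let _ : NonUnitalCStarAlgebra G := NonUnitalStarSubalgebra.nonUnitalCStarAlgebra G
  let π : G →⋆ₙₐ[ℂ] C := (NonUnitalStarAlgHom.fst ℂ C D).comp
    (NonUnitalStarSubalgebraClass.subtype G)
  have hπ : ∀ z : G, π z = z.1.1 := fun z => rfl
  have hinj : Function.Injective π := by
    refine (injective_iff_map_eq_zero π).mpr fun z hz => Subtype.ext (Prod.ext hz ?_)
    exact h1 _ z.2 hz
  -- An injective star homomorphism of C⋆-algebras is isometric, so the first coordinates form a
  -- closed algebra; since it contains $s$, it contains the whole C⋆-algebra that $s$ generates.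
  have hclosed : IsClosed (Set.range π) :=
    (NonUnitalStarAlgHom.isometry π hinj).isClosedEmbedding.isClosed_range
  have hle : (NonUnitalStarAlgebra.adjoin ℂ s).topologicalClosure ≤ NonUnitalStarAlgHom.range π := by
    refine NonUnitalStarSubalgebra.topologicalClosure_minimal _
      (NonUnitalStarAlgebra.adjoin_le fun a ha => ?_) hclosed
    obtain ⟨b, hb⟩ := hs a ha
    exact ⟨⟨(a, b), hb⟩, rfl⟩
  have hex : ∀ a : (NonUnitalStarAlgebra.adjoin ℂ s).topologicalClosure,
      ∃ b : D₀, (a.1, b.1) ∈ G := fun a => by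
    obtain ⟨z, hz⟩ := hle a.2
    refine ⟨⟨z.1.2, hD _ z.2⟩, ?_⟩
    have : ((a.1, z.1.2) : C × D) = z.1 := Prod.ext hz.symm rfl
    change ((a.1, z.1.2) : C × D) ∈ G
    rw [this]
    exact z.2
  choose f hf using hex
  -- Uniqueness of the second coordinate makes the chosen function a homomorphism: both sides of
  -- each law are second coordinates over the same first coordinate.
  have huniq : ∀ {a : C} {b b' : D}, (a, b) ∈ G → (a, b') ∈ G → b = b' := fun h h' =>
    sub_eq_zero.mp (h1 _ (G.sub_mem h h') (sub_self _))
  refine ⟨{ toFun := f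
            map_smul' := fun c a => Subtype.ext
              (huniq (hf (c • a)) (SMulMemClass.smul_mem c (hf a)))
            map_zero' := Subtype.ext (huniq (hf 0) G.zero_mem)
            map_add' := fun a b => Subtype.ext (huniq (hf (a + b)) (G.add_mem (hf a) (hf b)))
            map_mul' := fun a b => Subtype.ext (huniq (hf (a * b)) (G.mul_mem (hf a) (hf b)))
            map_star' := fun a => Subtype.ext (huniq (hf (star a)) (star_mem (hf a))) }, ?_, ?_⟩
  · refine (injective_iff_map_eq_zero _).mpr fun a ha => Subtype.ext ?_
    exact h2 _ (hf a) (congrArg Subtype.val ha)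
  · exact fun a b hab ha => huniq (hf ⟨a, ha⟩) hab

end Graphs

/-! ### Membership in and closedness of the spatial tensor product. -/

section SpatialTensor

variable {H : Type*} [NormedAddCommGroup H] [InnerProductSpace ℂ H] [CompleteSpace H]
variable {K : Type*} [NormedAddCommGroup K] [InnerProductSpace ℂ K] [CompleteSpace K]

theorem isClosed_cstarGen (s : Set (H →L[ℂ] H)) : IsClosed (cstarGen s : Set (H →L[ℂ] H)) :=
  NonUnitalStarSubalgebra.isClosed_topologicalClosure _

theorem mem_cstarGen {s : Set (H →L[ℂ] H)} {a : H →L[ℂ] H} (ha : a ∈ s) : a ∈ cstarGen s :=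
  NonUnitalStarSubalgebra.le_topologicalClosure _ (NonUnitalStarAlgebra.subset_adjoin ℂ _ ha)

theorem isClosed_spatialTensor (C : NonUnitalStarSubalgebra ℂ (H →L[ℂ] H))
    (D : NonUnitalStarSubalgebra ℂ (K →L[ℂ] K)) :
    IsClosed (spatialTensor C D : Set (HilbertTensor H K →L[ℂ] HilbertTensor H K)) :=
  isClosed_cstarGen _

theorem opTensor_mem_spatialTensor {C : NonUnitalStarSubalgebra ℂ (H →L[ℂ] H)}
    {D : NonUnitalStarSubalgebra ℂ (K →L[ℂ] K)} {c : H →L[ℂ] H} {d : K →L[ℂ] K} (hc : c ∈ C)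
    (hd : d ∈ D) : opTensor c d ∈ spatialTensor C D :=
  mem_cstarGen ⟨c, hc, d, hd, rfl⟩

end SpatialTensor

/-! ### The maps $F(X)\to H\otimes\ell^2(P)$ and the comparison of the two representations. -/

section FockIntertwiner

variable {A : Type*} [NonUnitalCStarAlgebra A] [PartialOrder A] [StarOrderedRing A]
variable {P : Type*} [Monoid P] [IsCancelMul P] {X : P → Type*}
  [∀ p, NormedAddCommGroup (X p)] [∀ p, NormedSpace ℂ (X p)] [∀ p, SMul Aᵐᵒᵖ (X p)]
  [∀ p, CStarModule Aᵐᵒᵖ (X p)] [∀ p, CompleteSpace (X p)]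
variable {S : ProductSystem A P X}

/-- The involution is defined through a chosen adjoint; uniqueness of adjoints identifies it with
the explicit one, `fockAdjLin`. -/
theorem ProductSystem.star_fock_coord (S : ProductSystem A P X) {p : P} (x : X p)
    (y : FockSpace (A := A) X) (r : P) :
    ((star (S.fock x)).1 y).coord r = S.annihilation (r := p * r) rfl x (y.coord (p * r)) := by
  have h : star (S.fock x) =
      ⟨(S.fockAdjLin x).mkContinuous ‖x‖ (S.norm_fockAdjLin_le x),
        (S.fockLin x).mkContinuous ‖x‖ (S.norm_fockLin_le x), fun y z => by
          rw [← CStarModule.star_inner]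
          change star (inner Aᵐᵒᵖ z (S.fockAdjLin x y)) = inner Aᵐᵒᵖ y (S.fockLin x z)
          rw [← S.inner_fockLin_adj, CStarModule.star_inner]⟩ :=
    star_eq_of fun y z => S.inner_fockLin_adj x y z
  rw [h]
  rfl

variable (A X) in
open scoped Classical in
/-- The element of the Fock space with a single nonzero coordinate. -/
def ProductSystem.fockSingle (s : P) (y : X s) : ProductSystem.FockSpace (A := A) X :=
  HilbertSum.mk (Pi.single s y) (summable_of_ne_finset_zero (s := {s}) fun r hr => by
    rw [Pi.single_eq_of_ne (by simpa using hr)]; simp)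

namespace ProductSystem.ToeplitzRep

variable {H : Type*} [NormedAddCommGroup H] [InnerProductSpace ℂ H] [CompleteSpace H]
variable (t : S.ToeplitzRep H)

/-- The functional `b ↦ ⟪h, t_e(b) k⟫`. -/
def coeffFunctional (h k : H) : Aᵐᵒᵖ →L[ℂ] ℂ :=
  (innerSL ℂ h) ∘L (ContinuousLinearMap.apply ℂ H k) ∘L
    LinearMap.mkContinuous
      { toFun := fun b : Aᵐᵒᵖ => t.coeffHom (unop b)
        map_add' := fun a b => by simp
        map_smul' := fun c a => by simp } 1
      (fun b => by rw [_root_.one_mul]; exact t.norm_coeffHom_le (unop b))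

theorem coeffFunctional_inner {p : P} (h k : H) (x y : X p) :
    t.coeffFunctional h k (inner Aᵐᵒᵖ x y) = inner ℂ (t.toFun p x h) (t.toFun p y k) := by
  change inner ℂ h (t.coeffHom (rip A x y) k) = _
  rw [← t.star_mul_self_eq, mul_apply_eq_comp, ContinuousLinearMap.star_eq_adjoint,
    ContinuousLinearMap.adjoint_inner_right]

variable (A X H) in
/-- The pairs of an adjointable operator on `F(X)` and an operator on `H ⊗ ℓ²(P)`. -/
abbrev FockPairs : Type _ := Adjointable Aᵐᵒᵖ (FockSpace (A := A) X) ×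
  (TensorSpace H (ell2 P) →L[ℂ] TensorSpace H (ell2 P))

theorem orthogonalFamily_slice :
    OrthogonalFamily ℂ (fun _ : P => H) (fun r => (slice r : H →ₗᵢ[ℂ] TensorSpace H (ell2 P))) :=
  fun _ _ hrs u v => inner_slice_of_ne hrs u v

/-- The terms are orthogonal, and their squared norms are the values of a continuous functional on
the summable family $\langle y_r,y_r\rangle$; summability in $\mathbb C$ is absolute. -/
theorem summable_slice (h : H) (y : FockSpace (A := A) X) :
    Summable fun r => (slice r (t.toFun r (y.coord r) h) : TensorSpace H (ell2 P)) := by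
  refine (orthogonalFamily_slice.summable_iff_norm_sq_summable _).mpr ?_
  have hs := (y.summable_self.map (t.coeffFunctional h h)
    (t.coeffFunctional h h).continuous).norm
  refine hs.congr fun r => ?_
  rw [Function.comp, t.coeffFunctional_inner, inner_self_eq_norm_sq_to_K]
  simp

/-- The map `F(X) → H ⊗ ℓ²(P)`, `(y_r) ↦ ∑ t_r(y_r) h ⊗ e_r`, as a linear map. -/
def fockEvalLin (h : H) : FockSpace (A := A) X →ₗ[ℂ] TensorSpace H (ell2 P) where
  toFun y := ∑' r, slice r (t.toFun r (y.coord r) h)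
  map_add' y z := by
    rw [← (t.summable_slice h y).tsum_add (t.summable_slice h z)]
    simp
  map_smul' c y := by
    rw [RingHom.id_apply, ← (t.summable_slice h y).tsum_const_smul]
    simp

theorem hasSum_fockEvalLin (h : H) (y : FockSpace (A := A) X) :
    HasSum (fun r => slice r (t.toFun r (y.coord r) h)) (t.fockEvalLin h y) :=
  (t.summable_slice h y).hasSum

theorem inner_slice_fockEvalLin (h u : H) (y : FockSpace (A := A) X) (r : P) :
    inner ℂ (slice r u) (t.fockEvalLin h y) = inner ℂ u (t.toFun r (y.coord r) h) := by
  have hs := (t.hasSum_fockEvalLin h y).mapL (innerSL ℂ (slice r u))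
  have h1 := hs.tsum_eq
  rw [tsum_eq_single r fun s hs => by
    rw [innerSL_apply_apply, inner_slice_of_ne hs.symm]] at h1
  rw [innerSL_apply_apply, innerSL_apply_apply, inner_slice] at h1
  exact h1.symm

/-- This is $\langle h,t_e(\langle y,z\rangle)k\rangle$, the inner product of $y\otimes h$ and
$z\otimes k$ in $F(X)\otimes_A H$: the maps for varying $h$ assemble to an isometry. -/
theorem inner_fockEvalLin (h k : H) (y z : FockSpace (A := A) X) :
    inner ℂ (t.fockEvalLin h y) (t.fockEvalLin k z) = t.coeffFunctional h k (inner Aᵐᵒᵖ y z) := by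
  have h1 := ((HilbertSum.summable_inner y z).hasSum.mapL (t.coeffFunctional h k)).tsum_eq
  have h2 := ((t.hasSum_fockEvalLin k z).mapL (innerSL ℂ (t.fockEvalLin h y))).tsum_eq
  rw [HilbertSum.inner_def, ← h1]
  rw [innerSL_apply_apply] at h2
  rw [← h2]
  refine tsum_congr fun r => ?_
  rw [innerSL_apply_apply, t.coeffFunctional_inner, ← inner_conj_symm, t.inner_slice_fockEvalLin,
    inner_conj_symm]

theorem norm_fockEvalLin_le (h : H) (y : FockSpace (A := A) X) :
    ‖t.fockEvalLin h y‖ ≤ ‖h‖ * ‖y‖ := by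
  refine le_of_sq_le_sq ?_ (by positivity)
  have h1 : ‖t.fockEvalLin h y‖ ^ 2 = ‖t.coeffFunctional h h (inner Aᵐᵒᵖ y y)‖ := by
    rw [← t.inner_fockEvalLin, inner_self_eq_norm_sq_to_K]; simp
  have h2 : ‖t.coeffFunctional h h (inner Aᵐᵒᵖ y y)‖ ≤ ‖h‖ * (‖inner Aᵐᵒᵖ y y‖ * ‖h‖) := by
    refine (norm_inner_le_norm h (t.coeffHom (unop (inner Aᵐᵒᵖ y y)) h)).trans ?_
    gcongr
    exact ContinuousLinearMap.le_of_opNorm_le _ (t.norm_coeffHom_le _) h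
  rw [h1, mul_pow, CStarModule.norm_sq_eq Aᵐᵒᵖ (x := y)]
  linarith

/-- The map `F(X) → H ⊗ ℓ²(P)`, `(y_r) ↦ ∑ t_r(y_r) h ⊗ e_r`. -/
def fockEval (h : H) : FockSpace (A := A) X →L[ℂ] TensorSpace H (ell2 P) :=
  (t.fockEvalLin h).mkContinuous ‖h‖ (t.norm_fockEvalLin_le h)

theorem hasSum_fockEval (h : H) (y : FockSpace (A := A) X) :
    HasSum (fun r => slice r (t.toFun r (y.coord r) h)) (t.fockEval h y) :=
  t.hasSum_fockEvalLin h y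

theorem fockEval_fockSingle (h : H) {s : P} (y : X s) :
    t.fockEval h (fockSingle A X s y) = slice s (t.toFun s y h) := by
  classical
  rw [← (t.hasSum_fockEval h _).tsum_eq, tsum_eq_single s fun r hr => ?_]
  · congr 3
    exact Pi.single_eq_same s y
  · have : (fockSingle A X s y).coord r = 0 := Pi.single_eq_of_ne hr y
    rw [this]; simp

theorem fell_fockEval {p : P} (x : X p) (h : H) (y : FockSpace (A := A) X) :
    t.fell x (t.fockEval h y) = t.fockEval h ((S.fock x).1 y) := by
  rw [← ((t.hasSum_fockEval h y).mapL (t.fell x)).tsum_eq, ← (t.hasSum_fockEval h _).tsum_eq,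
    ← (mul_right_injective p).tsum_eq
      (f := fun s => slice s (t.toFun s (((S.fock x).1 y).coord s) h))]
  · refine tsum_congr fun r => ?_
    rw [fell, tensorOp_slice (shift_basisVec p r), S.fock_coord rfl, ← t.map_mul rfl]
    rfl
  · intro s hs
    by_contra hn
    refine hs ?_
    change slice s (t.toFun s (((S.fock x).1 y).coord s) h) = 0
    rw [S.fock_coord_of_notMem hn, map_zero, zero_apply, map_zero]

/-- Needed separately from `fell_fockEval`, since the image of `fockEval` for a single $h$ need not
be dense. Coordinates outside $pP$ are killed by $V_p^*$; on the others $t_p(x)^*t_{pr}(y_{pr})$ is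
$t_r$ of the annihilated vector. -/
theorem star_fell_fockEval {p : P} (x : X p) (h : H) (y : FockSpace (A := A) X) :
    star (t.fell x) (t.fockEval h y) = t.fockEval h ((star (S.fock x)).1 y) := by
  rw [← ((t.hasSum_fockEval h y).mapL (star (t.fell x))).tsum_eq,
    ← (t.hasSum_fockEval h _).tsum_eq, ← (mul_right_injective p).tsum_eq
      (f := fun s => star (t.fell x) (slice s (t.toFun s (y.coord s) h)))]
  · refine tsum_congr fun r => ?_
    rw [fell, star_tensorOp, tensorOp_slice (star_shift_basisVec_mul p r), S.star_fock_coord,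
      ← t.star_toFun_mul_toFun rfl]
    rfl
  · intro s hs
    by_contra hn
    refine hs ?_
    change star (t.fell x) (slice s (t.toFun s (y.coord s) h)) = 0
    rw [fell, star_tensorOp, tensorOp_slice_of_eq_zero (star_shift_basisVec_of_notMem hn)]

/-- The pairs of operators on `F(X)` and on `H ⊗ ℓ²(P)` that, together with their adjoints, are
intertwined by all the maps `F(X) → H ⊗ ℓ²(P)`, `(y_r) ↦ ∑ t_r(y_r) h ⊗ e_r`. -/
def intertwinedPairs : NonUnitalStarSubalgebra ℂ (FockPairs A X H) where
  carrier := {z | (∀ h y, z.2 (t.fockEval h y) = t.fockEval h (z.1.1 y)) ∧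
    ∀ h y, star z.2 (t.fockEval h y) = t.fockEval h ((star z.1).1 y)}
  add_mem' {z w} hz hw := ⟨fun h y => by simp [hz.1, hw.1], fun h y => by simp [hz.2, hw.2]⟩
  zero_mem' := ⟨fun h y => by simp, fun h y => by simp⟩
  mul_mem' {z w} hz hw := ⟨fun h y => by simp [hz.1, hw.1], fun h y => by simp [hz.2, hw.2]⟩
  smul_mem' c z hz := ⟨fun h y => by simp [hz.1], fun h y => by simp [hz.2]⟩
  star_mem' {z} hz := ⟨hz.2, by simpa using hz.1⟩

theorem mem_intertwinedPairs {z : FockPairs A X H} :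
    z ∈ t.intertwinedPairs ↔ (∀ h y, z.2 (t.fockEval h y) = t.fockEval h (z.1.1 y)) ∧
      ∀ h y, star z.2 (t.fockEval h y) = t.fockEval h ((star z.1).1 y) := Iff.rfl

theorem isClosed_intertwinedPairs : IsClosed (t.intertwinedPairs : Set (FockPairs A X H)) := by
  have hval : Continuous fun a : Adjointable Aᵐᵒᵖ (FockSpace (A := A) X) => a.1 :=
    continuous_subtype_val
  have e : (t.intertwinedPairs : Set (FockPairs A X H)) =
      (⋂ h, ⋂ y, {z : FockPairs A X H | z.2 (t.fockEval h y) = t.fockEval h (z.1.1 y)}) ∩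
      ⋂ h, ⋂ y, {z : FockPairs A X H | star z.2 (t.fockEval h y) = t.fockEval h ((star z.1).1 y)} := by
    ext z
    simp [mem_intertwinedPairs]
  rw [e]
  refine (isClosed_iInter fun h => isClosed_iInter fun y => isClosed_eq ?_ ?_).inter
    (isClosed_iInter fun h => isClosed_iInter fun y => isClosed_eq ?_ ?_)
  · exact continuous_snd.clm_apply continuous_const
  · exact (t.fockEval h).continuous.comp
      ((hval.comp continuous_fst).clm_apply continuous_const)
  · exact continuous_snd.star.clm_apply continuous_const
  · exact (t.fockEval h).continuous.comp
      ((hval.comp continuous_fst.star).clm_apply continuous_const)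

/-- If the second coordinate is zero, `fockEval` kills the range of the first, $T$, for every vector
of $H$. The inner product formula then gives $t_e(\langle Ty,Ty\rangle)=0$. -/
theorem fst_eq_zero_of_mem_intertwinedPairs (ht : t.IsInjective)
    {z : FockPairs A X H}
    (hz : z ∈ t.intertwinedPairs) (h0 : z.2 = 0) : z.1 = 0 := by
  refine Subtype.ext (ContinuousLinearMap.ext fun y => ?_)
  have h1 : t.coeffHom (rip A (z.1.1 y) (z.1.1 y)) = 0 := by
    ext k
    refine ext_inner_left ℂ fun h => ?_
    have h2 := t.inner_fockEvalLin h k (z.1.1 y) (z.1.1 y)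
    have h3 : t.fockEvalLin k (z.1.1 y) = 0 := by
      have := hz.1 k y
      rw [h0, zero_apply] at this
      exact this.symm
    rw [h3, inner_zero_right] at h2
    rw [zero_apply, inner_zero_right]
    exact h2.symm
  have h2 : S.coeff (rip A (z.1.1 y) (z.1.1 y)) = 0 := ht (by rw [map_zero]; exact h1)
  have h3 : rip A (z.1.1 y) (z.1.1 y) = 0 := by simpa using h2
  exact CStarModule.inner_self.mp (unop_injective h3)

/-- The C⋆-algebra generated by the operators `t_p(x) ⊗ V_p`. -/
def fellAlgebra : NonUnitalStarSubalgebra ℂ (TensorSpace H (ell2 P) →L[ℂ] TensorSpace H (ell2 P)) :=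
  (NonUnitalStarAlgebra.adjoin ℂ {T | ∃ (p : P) (x : X p), T = t.fell x}).topologicalClosure

/-- The closed graph of the correspondence between the Fock representation and the
representation `x ↦ t_p(x) ⊗ V_p`. -/
def fellGraph : NonUnitalStarSubalgebra ℂ (FockPairs A X H) :=
  (NonUnitalStarAlgebra.adjoin ℂ
    {z | ∃ (p : P) (x : X p), z = (S.fock x, t.fell x)}).topologicalClosure

theorem fellGraph_le_intertwinedPairs : t.fellGraph ≤ t.intertwinedPairs := by
  refine NonUnitalStarSubalgebra.topologicalClosure_minimal _
    (NonUnitalStarAlgebra.adjoin_le ?_) t.isClosed_intertwinedPairs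
  rintro _ ⟨p, x, rfl⟩
  exact ⟨fun h y => t.fell_fockEval x h y, fun h y => t.star_fell_fockEval x h y⟩

theorem snd_mem_fellAlgebra {z : FockPairs A X H} (hz : z ∈ t.fellGraph) :
    z.2 ∈ t.fellAlgebra := by
  let N : NonUnitalStarSubalgebra ℂ (FockPairs A X H) := t.fellAlgebra.comap
    (NonUnitalStarAlgHom.snd ℂ (Adjointable Aᵐᵒᵖ (FockSpace (A := A) X))
      (TensorSpace H (ell2 P) →L[ℂ] TensorSpace H (ell2 P)))
  have hA : IsClosed (t.fellAlgebra : Set (TensorSpace H (ell2 P) →L[ℂ] TensorSpace H (ell2 P))) :=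
    NonUnitalStarSubalgebra.isClosed_topologicalClosure _
  have hc : IsClosed (N : Set (FockPairs A X H)) := hA.preimage continuous_snd
  change z ∈ N
  refine NonUnitalStarSubalgebra.topologicalClosure_minimal _
    (NonUnitalStarAlgebra.adjoin_le ?_) hc hz
  rintro _ ⟨p, x, rfl⟩
  exact NonUnitalStarSubalgebra.le_topologicalClosure _
    (NonUnitalStarAlgebra.subset_adjoin ℂ _ ⟨p, x, rfl⟩)

variable {t}

theorem IsLCMCovariant.fellAlgebra_le_fellSpan (hP : IsRightLCM P) (hL : t.IsLCMCovariant)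
    {a : TensorSpace H (ell2 P) →L[ℂ] TensorSpace H (ell2 P)} (ha : a ∈ t.fellAlgebra) :
    a ∈ t.fellSpan :=
  closure_minimal (fun _ hb => hL.adjoin_le_fellSpan hP hb) t.isClosed_fellSpan ha

/-- On single-coordinate vectors `fockEval` takes the values $t_s(x)h\otimes e_s$, so $b$ vanishes
on each $[t_s(X_s)H]\otimes e_s$. The diagonal argument then applies to $b^*b$, which lies in the
closed span. -/
theorem IsLCMCovariant.eq_zero_of_fockEval (hP : IsRightLCM P) (hL : t.IsLCMCovariant)
    {b : TensorSpace H (ell2 P) →L[ℂ] TensorSpace H (ell2 P)} (hb : b ∈ t.fellAlgebra)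
    (h0 : ∀ h y, b (t.fockEval h y) = 0) : b = 0 := by
  refine eq_zero_of_diagEntry_star_mul_self fun r => ?_
  refine hL.diagEntry_eq_zero hP
    (hL.fellAlgebra_le_fellSpan hP (mul_mem (star_mem hb) hb)) (fun s u hu => ?_) r
  have hk : b (slice s u) = 0 := by
    have : (b ∘L (slice s).toContinuousLinearMap) u ∈ (⊥ : Submodule ℂ (TensorSpace H (ell2 P))) := by
      refine map_mem_of_mem_closure_span _ isClosed_singleton ?_ hu
      rintro _ ⟨x, h, rfl⟩
      rw [Submodule.mem_bot]
      change b (slice s (t.toFun s x h)) = 0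
      rw [← t.fockEval_fockSingle, h0]
    exact this
  rw [mul_apply_eq_comp, hk, map_zero]

variable (t) in
/-- The algebra `C*(t) ⊗ C*_λ(P)`. -/
def tensorAlgebra :
    NonUnitalStarSubalgebra ℂ (TensorSpace H (ell2 P) →L[ℂ] TensorSpace H (ell2 P)) :=
  spatialTensor t.cstar (regularCStar P)

theorem mem_tensorAlgebra_of_mem_fellAlgebra
    {a : TensorSpace H (ell2 P) →L[ℂ] TensorSpace H (ell2 P)} (ha : a ∈ t.fellAlgebra) :
    a ∈ t.tensorAlgebra := by
  have hc : IsClosed (t.tensorAlgebra :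
      Set (TensorSpace H (ell2 P) →L[ℂ] TensorSpace H (ell2 P))) :=
    isClosed_spatialTensor t.cstar (regularCStar P)
  refine NonUnitalStarSubalgebra.topologicalClosure_minimal _
    (NonUnitalStarAlgebra.adjoin_le ?_) hc ha
  rintro _ ⟨p, x, rfl⟩
  exact opTensor_mem_spatialTensor (t.mem_cstar x) (shift_mem p)

theorem IsLCMCovariant.exists_starHom (hP : IsRightLCM P) (hL : t.IsLCMCovariant)
    (ht : t.IsInjective) :
    ∃ φ : S.fockAlgebra →⋆ₙₐ[ℂ] t.tensorAlgebra,
      Function.Injective φ ∧ ∀ (p : P) (x : X p),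
        (φ ⟨S.fock x, S.fock_mem x⟩ : TensorSpace H (ell2 P) →L[ℂ] TensorSpace H (ell2 P)) =
          t.fell x := by
  have hmem : ∀ {p : P} (x : X p), (S.fock x, t.fell x) ∈ t.fellGraph := fun {p} x =>
    NonUnitalStarSubalgebra.le_topologicalClosure _
      (NonUnitalStarAlgebra.subset_adjoin ℂ _ ⟨p, x, rfl⟩)
  obtain ⟨φ, hφ, hφ'⟩ := exists_starHom_of_graph t.fellGraph
    (NonUnitalStarSubalgebra.isClosed_topologicalClosure _)
    (fun z hz h0 => hL.eq_zero_of_fockEval hP (t.snd_mem_fellAlgebra hz) fun h y => by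
      rw [(t.fellGraph_le_intertwinedPairs hz).1, h0]; simp)
    (fun z hz h0 => t.fst_eq_zero_of_mem_intertwinedPairs ht
      (t.fellGraph_le_intertwinedPairs hz) h0)
    {T | ∃ (p : P) (x : X p), T = S.fock x}
    (by rintro _ ⟨p, x, rfl⟩; exact ⟨_, hmem x⟩)
    t.tensorAlgebra
    (fun z hz => mem_tensorAlgebra_of_mem_fellAlgebra (t.snd_mem_fellAlgebra hz))
  exact ⟨φ, hφ, fun p x => hφ' _ _ (hmem x) _⟩

end ProductSystem.ToeplitzRep

end FockIntertwiner

end ProdSys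

end

/-- A submonoid of a group is cancellative on both sides, and `TensorSpace` unfolds to
`HilbertTensor`, so the general result applies as it stands. -/
theorem proposition4p5 {G : Type*} [Group G] (P : Submonoid G) (hP : IsRightLCM P)
    {A : Type*} [NonUnitalCStarAlgebra A] [PartialOrder A] [StarOrderedRing A]
    {X : P → Type*} [∀ p, NormedAddCommGroup (X p)] [∀ p, NormedSpace ℂ (X p)]
    [∀ p, SMul Aᵐᵒᵖ (X p)] [∀ p, CStarModule Aᵐᵒᵖ (X p)] [∀ p, CompleteSpace (X p)]
    (S : ProductSystem A P X) (hS : S.IsCompactlyAligned)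
    {H : Type*} [NormedAddCommGroup H] [InnerProductSpace ℂ H] [CompleteSpace H]
    (t : S.ToeplitzRep H) (hN : t.IsNicaCovariant hS) (ht : t.IsInjective) :
    ∃ φ : S.fockAlgebra →⋆ₙₐ[ℂ] spatialTensor t.cstar (regularCStar P),
      Function.Injective φ ∧
      ∀ (p : P) (x : X p),
        (φ ⟨S.fock x, S.fock_mem x⟩ : HilbertTensor H (ell2 P) →L[ℂ] HilbertTensor H (ell2 P)) =
          opTensor (t.toFun p x) (shift p) :=
  ProductSystem.ToeplitzRep.IsLCMCovariant.exists_starHom hP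
    (ProductSystem.ToeplitzRep.IsNicaCovariant.isLCMCovariant hN) ht
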